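/- Let $p_1,p_2\in[0,1]$ and consider the memoryless broadcast channel $W$ with input $X\in\{0,1\}$ and outputs $Y_1,Y_2\in\{0,1,e\}$ that is made up of two independent binary erasure channels, $W(y_1,y_2|x)=P_{Y_1|X}(y_1|x)\,P_{Y_2|X}(y_2|x)$, where $P_{Y_i|X}$ is BEC($p_i$), i.e. $P_{Y_i|X}(e|x)=p_i$ and $P_{Y_i|X}(x|x)=1-p_i$. Let $n,k_1,k_2\in\mathbb N$. In an $(n,k_1,k_2)$ oblivious transfer protocol, Alice has four strings $M_{i0},M_{i1}\in\{0,1\}^{k_i}$ and Bob-$i$ has a choice bit $Z_i$ ($i\in\{1,2\}$); all of them are independent and uniform. Alice and the two Bobs have independent private randomness $R_A,R_{B_1},R_{B_2}$, independent also of the strings and choice bits. The channel $W$ is used $n$ times, Alice choosing the input and Bob-$i$ observing the $i$-th output; given its input, each output pair is independent of the past. Before every channel use and after the last one the users exchange finitely many messages from countable alphabets over a noiseless public channel heard by everybody. Everything a user sends is a function of his own inputs, his private randomness and what he has sent and observed so far. Let $\mathbf C$ be the public transcript, $U=(M_{10},M_{11},M_{20},M_{21},R_A,X^n,\mathbf C)$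 the final view of Alice and $V_i=(Z_i,R_{B_i},Y_i^n,\mathbf C)$ that of Bob-$i$, from which he computes an estimate $\hat M_{iZ_i}$ of $M_{iZ_i}$. Write $\overline Z_i=1-Z_i$ and $\overline i=3-i$. A pair $(R_1,R_2)$ is an achievable rate pair with colluding (honest-but-curious) parties if there are $(n,k_1,k_2)$ protocols, one for every $n$, with $k_i=k_i(n)$ and $k_i/n\to R_i$, such that, as $n\to\infty$, for both $i\in\{1,2\}$, $$\Pr[\hat M_{iZ_i}\ne M_{iZ_i}]\to0,\qquad I(M_{1\overline Z_1},M_{2\overline Z_2};V_1,V_2)\to0,\qquad I(Z_i;U,V_{\overline i})\to0,$$ $$I(Z_1,Z_2;U)\to0,\qquad I(M_{i0},M_{i1},M_{\overline i\,\overline Z_{\overline i}},Z_i;V_{\overline i})\to0 .$$ Let $\mathcal R$ be the set of all achievable rate pairs. Then $\mathcal R\subseteq\mathcal R_{\mathrm{outer}}$, where $\mathcal R_{\mathrm{outer}}$ is the set of all $(R_1,R_2)$ with $R_1,R_2\ge0$ and $$R_1\le p_2\min\{p_1,1-p_1\},\qquad R_2\le p_1\min\{p_2,1-p_2\},\qquad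 R_1+R_2\le\min\{p_1p_2,\,1-p_1p_2\}.$$ -/

import Mathlib

open MeasureTheory Filter Topology
open scoped ENNReal

noncomputable section

namespace BroadcastOT

/-- Finite sequences over a countable alphabet carry the discrete σ-algebra. -/
instance instMeasurableSpaceList {α : Type} [Countable α] : MeasurableSpace (List α) := ⊤

/-- The output alphabet `{0, 1, e}` of a binary erasure channel, with `none` as the erasure symbol,
carries the discrete σ-algebra. -/
instance instMeasurableSpaceErasure : MeasurableSpace (Option Bool) := ⊤

/-- The mutual information `I(S;T)` of two random variables on a probability space: the
Kullback-Leibler divergence of their joint law from the product of their laws.  It is valued in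
`[0, ∞]` and measured in nats. -/
def mutualInfo {Ω α β : Type} [MeasurableSpace Ω] [MeasurableSpace α] [MeasurableSpace β]
    (P : Measure Ω) (S : Ω → α) (T : Ω → β) : ℝ≥0∞ :=
  InformationTheory.klDiv (P.map fun ω => (S ω, T ω)) ((P.map S).prod (P.map T))

/-- The three users.  The receivers Bob-1 and Bob-2 are numbered by `0` and `1` in `Fin 2`; the
other receiver than `i` is `i.rev`. -/
inductive User
  | alice
  | bob (i : Fin 2)

/-- All that has happened on the channels so far: the channel inputs, the channel outputs at each
receiver, and the messages on the public channel, each in chronological order. -/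
structure History (𝒳 𝒴 : Type) where
  inputs : List 𝒳
  outputs : Fin 2 → List 𝒴
  pub : List ℕ

/-- An `(n, k₁, k₂)` protocol over a broadcast channel with input alphabet `𝒳` and output
alphabet `𝒴` at either receiver.  Public discussion takes place before every channel use and after
the last one: `rounds l` public messages are sent between the `l`-th and the `(l+1)`-st channel
use.  A public message is heard by everybody and comes from an arbitrary countable alphabet, coded
by natural numbers; `speaker j` sends the one that is preceded by exactly `j` others. -/
structure Protocol (𝒳 𝒴 : Type) (n : ℕ) (k : Fin 2 → ℕ) where
  /-- Alice's private randomness -/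
  RA : Type
  [measurableSpaceRA : MeasurableSpace RA]
  lawRA : Measure RA
  [isProbabilityMeasureRA : IsProbabilityMeasure lawRA]
  /-- the private randomness of the two receivers -/
  RB : Fin 2 → Type
  [measurableSpaceRB : ∀ i, MeasurableSpace (RB i)]
  lawRB : ∀ i, Measure (RB i)
  [isProbabilityMeasureRB : ∀ i, IsProbabilityMeasure (lawRB i)]
  rounds : ℕ → ℕ
  speaker : ℕ → User
  /-- Alice's next public message, from her strings `m i b` (the string with label `b` for
  Bob-`i`), her private randomness, her past channel inputs and the past public messages -/
  msgA : (∀ i, Bool → Fin (k i) → Bool) → RA → List 𝒳 → List ℕ → ℕ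
  /-- Alice's next channel input, from the same data -/
  input : (∀ i, Bool → Fin (k i) → Bool) → RA → List 𝒳 → List ℕ → 𝒳
  /-- the next public message of Bob-`i`, from his choice bit, his private randomness, his past
  channel outputs and the past public messages -/
  msgB : ∀ i, Bool → RB i → List 𝒴 → List ℕ → ℕ
  /-- the final estimate of the chosen string by Bob-`i`, from the same data -/
  estimate : ∀ i, Bool → RB i → List 𝒴 → List ℕ → (Fin (k i) → Bool)
  measurable_msgA : ∀ m xs c, Measurable fun r => msgA m r xs c
  measurable_input : ∀ m xs c x, MeasurableSet {r | input m r xs c = x}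
  measurable_msgB : ∀ i z ys c, Measurable fun r => msgB i z r ys c
  measurable_estimate : ∀ i z ys c, Measurable fun r => estimate i z r ys c

attribute [instance] Protocol.measurableSpaceRA Protocol.isProbabilityMeasureRA
  Protocol.measurableSpaceRB Protocol.isProbabilityMeasureRB

namespace Protocol

variable {𝒳 𝒴 : Type} {n : ℕ} {k : Fin 2 → ℕ}

/-- The sample space of one execution: Alice's strings, the choice bits, the private randomness of
the three users, and the channel noise.  The noise of one channel use is a table that holds, for
every possible input letter, the pair of letters that the receivers would then observe. -/
abbrev Sample (π : Protocol 𝒳 𝒴 n k) : Type :=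
  ((∀ i, Bool → Fin (k i) → Bool) × (Fin 2 → Bool)) × (π.RA × (∀ i, π.RB i)) ×
    (Fin n → 𝒳 → Fin 2 → 𝒴)

/-- The law of an execution over the memoryless broadcast channel that answers the input `x` with a
pair of outputs of law `W x`: the four strings and the two choice bits are independent and uniform,
and they, the three private randomnesses and the noise of the `n` channel uses are independent.
As the noise table of a channel use has entry `x` of law `W x` and is independent of all that
precedes this use, the pair of outputs has, given the past and the input `x`, the law `W x`. -/
def law [Fintype 𝒳] [MeasurableSpace 𝒴] (π : Protocol 𝒳 𝒴 n k)
    (W : 𝒳 → Measure (Fin 2 → 𝒴)) : Measure π.Sample :=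
  (ProbabilityTheory.uniformOn Set.univ).prod
    ((π.lawRA.prod (Measure.pi π.lawRB)).prod (Measure.pi fun _ => Measure.pi W))

/-- Alice's string with label `b` for Bob-`i`. -/
def string (π : Protocol 𝒳 𝒴 n k) (i : Fin 2) (b : Bool) (ω : π.Sample) : Fin (k i) → Bool :=
  ω.1.1 i b

/-- The choice bit of Bob-`i`. -/
def choice (π : Protocol 𝒳 𝒴 n k) (i : Fin 2) (ω : π.Sample) : Bool := ω.1.2 i

/-- The string that Bob-`i` chooses. -/
def chosen (π : Protocol 𝒳 𝒴 n k) (i : Fin 2) (ω : π.Sample) : Fin (k i) → Bool :=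
  π.string i (π.choice i ω) ω

/-- The string that Bob-`i` does not choose. -/
def unchosen (π : Protocol 𝒳 𝒴 n k) (i : Fin 2) (ω : π.Sample) : Fin (k i) → Bool :=
  π.string i (!π.choice i ω) ω

/-- One public message. -/
def sendPublic (π : Protocol 𝒳 𝒴 n k) (ω : π.Sample) (h : History 𝒳 𝒴) : History 𝒳 𝒴 :=
  { h with
    pub := h.pub ++
      [match π.speaker h.pub.length with
        | .alice => π.msgA ω.1.1 ω.2.1.1 h.inputs h.pub
        | .bob i => π.msgB i (ω.1.2 i) (ω.2.1.2 i) (h.outputs i) h.pub] }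

/-- The `l`-th session of public discussion. -/
def session (π : Protocol 𝒳 𝒴 n k) (ω : π.Sample) (l : ℕ) (h : History 𝒳 𝒴) : History 𝒳 𝒴 :=
  (π.sendPublic ω)^[π.rounds l] h

/-- The channel use with index `l`. -/
def useChannel (π : Protocol 𝒳 𝒴 n k) (ω : π.Sample) (l : Fin n) (h : History 𝒳 𝒴) :
    History 𝒳 𝒴 :=
  let x := π.input ω.1.1 ω.2.1.1 h.inputs h.pub
  { inputs := h.inputs ++ [x]
    outputs := fun i => h.outputs i ++ [ω.2.2 l x i]
    pub := h.pub }

/-- The complete execution: a session of public discussion, and then `n` times a channel use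
followed by a session of public discussion. -/
def run (π : Protocol 𝒳 𝒴 n k) (ω : π.Sample) : History 𝒳 𝒴 :=
  (List.finRange n).foldl (fun h (l : Fin n) => π.session ω (l.val + 1) (π.useChannel ω l h))
    (π.session ω 0 ⟨[], fun _ => [], []⟩)

/-- Alice's final view `U`: her four strings, her private randomness, the channel inputs and the
public transcript. -/
def viewA (π : Protocol 𝒳 𝒴 n k) (ω : π.Sample) :
    (∀ i, Bool → Fin (k i) → Bool) × π.RA × List 𝒳 × List ℕ :=
  (ω.1.1, ω.2.1.1, (π.run ω).inputs, (π.run ω).pub)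

/-- The final view `V_i` of Bob-`i`: his choice bit, his private randomness, his channel outputs
and the public transcript. -/
def viewB (π : Protocol 𝒳 𝒴 n k) (i : Fin 2) (ω : π.Sample) :
    Bool × π.RB i × List 𝒴 × List ℕ :=
  (ω.1.2 i, ω.2.1.2 i, (π.run ω).outputs i, (π.run ω).pub)

/-- The estimate that Bob-`i` computes from his final view. -/
def guess (π : Protocol 𝒳 𝒴 n k) (i : Fin 2) (ω : π.Sample) : Fin (k i) → Bool :=
  π.estimate i (ω.1.2 i) (ω.2.1.2 i) ((π.run ω).outputs i) (π.run ω).pub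

end Protocol

/-- The protocols `π n` achieve oblivious transfer over the memoryless broadcast channel `W` at the
rate pair `(R 0, R 1)`, with honest-but-curious parties that may collude. -/
structure AchievesColluding {𝒳 𝒴 : Type} [Fintype 𝒳] [Finite 𝒴] [MeasurableSpace 𝒴]
    (W : 𝒳 → Measure (Fin 2 → 𝒴)) (R : Fin 2 → ℝ) (k : ℕ → Fin 2 → ℕ)
    (π : ∀ n, Protocol 𝒳 𝒴 n (k n)) : Prop where
  rate : ∀ i, Tendsto (fun n => (k n i : ℝ) / n) atTop (𝓝 (R i))
  correct : ∀ i, Tendsto (fun n => (π n).law W {ω | (π n).guess i ω ≠ (π n).chosen i ω})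
    atTop (𝓝 0)
  /-- the receivers together learn nothing about the two unchosen strings -/
  secure_strings : Tendsto (fun n => mutualInfo ((π n).law W)
    (fun ω i => (π n).unchosen i ω) (fun ω i => (π n).viewB i ω)) atTop (𝓝 0)
  /-- Alice and the other receiver together learn nothing about a choice bit -/
  secure_choice : ∀ i, Tendsto (fun n => mutualInfo ((π n).law W)
    ((π n).choice i) (fun ω => ((π n).viewA ω, (π n).viewB i.rev ω))) atTop (𝓝 0)
  /-- Alice learns nothing about the two choice bits -/
  secure_choices : Tendsto (fun n => mutualInfo ((π n).law W)
    (fun ω i => (π n).choice i ω) (π n).viewA) atTop (𝓝 0)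
  /-- the other receiver alone learns nothing about the two strings for Bob-`i`, the string he has
  not chosen himself, and the choice bit of Bob-`i` -/
  secure_single : ∀ i, Tendsto (fun n => mutualInfo ((π n).law W)
    (fun ω => ((π n).string i false ω, (π n).string i true ω, (π n).unchosen i.rev ω,
      (π n).choice i ω))
    ((π n).viewB i.rev)) atTop (𝓝 0)

/-- The oblivious transfer rate region with colluding parties: the set of all achievable rate
pairs. -/
def rateRegionColluding {𝒳 𝒴 : Type} [Fintype 𝒳] [Finite 𝒴] [MeasurableSpace 𝒴]
    (W : 𝒳 → Measure (Fin 2 → 𝒴)) : Set (Fin 2 → ℝ) :=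
  {R | ∃ (k : ℕ → Fin 2 → ℕ) (π : ∀ n, Protocol 𝒳 𝒴 n (k n)), AchievesColluding W R k π}

/-- The binary erasure channel with erasure probability `p`. -/
def bec (p : ℝ) (x : Bool) : Measure (Option Bool) :=
  ENNReal.ofReal (1 - p) • Measure.dirac (some x) + ENNReal.ofReal p • Measure.dirac none

/-- The broadcast channel made up of two independent binary erasure channels:
`W(y₁, y₂ | x) = P(y₁ | x) P(y₂ | x)`. -/
def independentBEC (p : Fin 2 → ℝ) (x : Bool) : Measure (Fin 2 → Option Bool) :=
  Measure.pi fun i => bec (p i) x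

end BroadcastOT

end

/-! Three bounds carry the theorem: `R i ≤ p i.rev * (1 - p i)`, `R 0 + R 1 ≤ p 0 * p 1` and `R i ≥
0`; the others follow by arithmetic. No entropy calculus is needed. A small mutual information means
that events have nearly the same probability under the joint law and under the product of the
marginals (`measure_le_add_of_klDiv_le`), and the rest is counting and change of measure. All errors
need only stay below a constant.

The structural fact is that an execution is a rectangle: the set where all discrete data take given
values is a product of events belonging to Alice, to each Bob and to the noise
(`exists_outcome_preimage_eq`). So the law factors, with factors independent of the channel apart
from one product over the channel uses (`exists_law_outcome_eq`). This gives conditional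
independence, and comparison of one protocol over two channels.

Single rate (`one_le_of_secure_single`): let the output at Bob-`i` be generated from the other
output. Then, given the other receiver's outputs and the transcript, Bob-`i` is independent of
Alice's strings, so his guess is rarely right outside a short list known to the other receiver.
Returning to the true channel costs a factor 2 for each position erased at the other receiver only.
By secrecy the list contains the chosen string with probability little more than 1/4.

Sum rate (`one_le_of_secure_strings`): the chosen string is decodable from the choice bit, the
channel inputs and the transcript. Alice cannot tell the choice bit from its negation, so the
unchosen string is decodable with the flipped bit. Together the Bobs know the inputs up to the
positions erased at both, and so hold a list for both unchosen strings, of size 2 to the number of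
such positions; secrecy forces it to be long. -/

noncomputable section

namespace BroadcastOT

/-! ### The product structure of an execution -/

/-- The first `n` entries of a list, padded by the default letter. -/
def firstEntries {α : Type} [Inhabited α] (n : ℕ) (L : List α) : Fin n → α :=
  fun j => L.getD j default

theorem firstEntries_ofFn {α : Type} [Inhabited α] {n : ℕ} (x : Fin n → α) :
    firstEntries n (List.ofFn x) = x := by
  funext j
  simp [firstEntries]

theorem ofFn_firstEntries {α : Type} [Inhabited α] {n : ℕ} {L : List α} (h : L.length = n) :
    List.ofFn (firstEntries n L) = L := by
  subst h
  apply List.ext_getElem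
  · simp
  · intro i h1 h2
    simp [firstEntries, h2]

/-- The history with public transcript `c` in which the first `l` letters of `x` have been sent
and the first `l` letters of `y i` have been received by Bob-`i`. -/
def History.truncated {𝒳 𝒴 : Type} {n : ℕ} (l : ℕ) (x : Fin n → 𝒳) (y : Fin 2 → Fin n → 𝒴)
    (c : List ℕ) : History 𝒳 𝒴 :=
  ⟨(List.ofFn x).take l, fun i => (List.ofFn (y i)).take l, c⟩

namespace Protocol

variable {𝒳 𝒴 : Type} {n : ℕ} {k : Fin 2 → ℕ}

/-- After `l` channel uses, the history `G` takes each of its values on a product of events that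
belong to Alice, to the receivers and to the noise. -/
def HasProductForm (π : Protocol 𝒳 𝒴 n k) (l : ℕ) (G : π.Sample → History 𝒳 𝒴) : Prop :=
  ∃ (A : (∀ i, Bool → Fin (k i) → Bool) → (Fin n → 𝒳) → List ℕ → Set π.RA)
    (B : ∀ i, Bool → (Fin n → 𝒴) → List ℕ → Set (π.RB i)),
    (∀ s x c, MeasurableSet (A s x c)) ∧ (∀ i z y c, MeasurableSet (B i z y c)) ∧
    ∀ x y c ω, G ω = History.truncated l x y c ↔
      ω.2.1.1 ∈ A ω.1.1 x c ∧ (∀ i, ω.2.1.2 i ∈ B i (ω.1.2 i) (y i) c) ∧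
        ∀ j : Fin n, j.val < l → ω.2.2 j (x j) = fun i => y i j

theorem hasProductForm_empty (π : Protocol 𝒳 𝒴 n k) :
    π.HasProductForm 0 (fun _ => ⟨[], fun _ => [], []⟩) := by
  refine ⟨fun _ _ c => {_r | c = []}, fun _ _ _ _ => Set.univ, fun _ _ _ => .const _,
    fun _ _ _ _ => .univ, fun x y c ω => ?_⟩
  simp [History.truncated, eq_comm]

theorem HasProductForm.sendPublic {π : Protocol 𝒳 𝒴 n k} {l : ℕ} {G : π.Sample → History 𝒳 𝒴}
    (h : π.HasProductForm l G) : π.HasProductForm l (fun ω => π.sendPublic ω (G ω)) := by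
  obtain ⟨A, B, hA, hB, hG⟩ := h
  -- Only the speaker's event shrinks: the last entry of `c` must be his message after `c.dropLast`.
  -- For `c = []` his condition fails, as it must once a message has been sent.
  refine ⟨fun s x c => {r | r ∈ A s x c.dropLast ∧ (π.speaker c.dropLast.length = .alice →
      c = c.dropLast ++ [π.msgA s r ((List.ofFn x).take l) c.dropLast])},
    fun i z y c => {r | r ∈ B i z y c.dropLast ∧ (π.speaker c.dropLast.length = .bob i →
      c = c.dropLast ++ [π.msgB i z r ((List.ofFn y).take l) c.dropLast])}, ?_, ?_, ?_⟩
  · intro s x c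
    refine (hA _ _ _).inter (.imp (.const _) ?_)
    exact π.measurable_msgA s _ _ (MeasurableSet.of_discrete (s := {v | c = c.dropLast ++ [v]}))
  · intro i z y c
    refine (hB _ _ _ _).inter (.imp (.const _) ?_)
    exact π.measurable_msgB i z _ _
      (MeasurableSet.of_discrete (s := {v | c = c.dropLast ++ [v]}))
  · intro x y c ω
    have key : π.sendPublic ω (G ω) = History.truncated l x y c ↔
        G ω = History.truncated l x y c.dropLast ∧
          c = (π.sendPublic ω (History.truncated l x y c.dropLast)).pub := by
      constructor
      · intro he
        have hc : c.dropLast = (G ω).pub := by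
          have := congrArg History.pub he
          simp only [Protocol.sendPublic, History.truncated] at this
          rw [← this, List.dropLast_concat]
        have hG' : G ω = History.truncated l x y c.dropLast := by
          have h1 := congrArg History.inputs he
          have h2 := congrArg History.outputs he
          simp only [Protocol.sendPublic, History.truncated] at h1 h2 ⊢
          rw [hc, ← h1, ← h2]
        refine ⟨hG', ?_⟩
        rw [← hG', he]
        rfl
      · rintro ⟨h1, h2⟩
        rw [h1]
        conv_rhs => rw [h2]
        rfl
    rw [key, hG]
    simp only [Protocol.sendPublic, History.truncated, Set.mem_ofPred_eq]
    cases hs : π.speaker c.dropLast.length with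
    | alice => simp only [reduceCtorEq, false_imp_iff, and_true, true_imp_iff]; tauto
    | bob i =>
      simp only [reduceCtorEq, false_imp_iff, and_true, User.bob.injEq]
      constructor
      · rintro ⟨⟨h1, h2, h3⟩, h4⟩
        refine ⟨h1, fun j => ⟨h2 j, ?_⟩, h3⟩
        rintro rfl
        exact h4
      · rintro ⟨h1, h2, h3⟩
        exact ⟨⟨h1, fun j => (h2 j).1, h3⟩, (h2 i).2 rfl⟩

theorem HasProductForm.session {π : Protocol 𝒳 𝒴 n k} {l : ℕ} {G : π.Sample → History 𝒳 𝒴}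
    (h : π.HasProductForm l G) (t : ℕ) :
    π.HasProductForm l (fun ω => π.session ω t (G ω)) := by
  unfold Protocol.session
  induction π.rounds t with
  | zero => exact h
  | succ m ih =>
    simp only [Function.iterate_succ_apply']
    exact ih.sendPublic

theorem HasProductForm.useChannel {π : Protocol 𝒳 𝒴 n k} {G : π.Sample → History 𝒳 𝒴}
    (l : Fin n) (h : π.HasProductForm l G) :
    π.HasProductForm (l + 1) (fun ω => π.useChannel ω l (G ω)) := by
  obtain ⟨A, B, hA, hB, hG⟩ := h
  -- A channel use constrains Alice, whose input must be `x l`, and the noise table at `l`; the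
  -- events of the receivers stay.
  refine ⟨fun s x c => {r | r ∈ A s x c ∧ π.input s r ((List.ofFn x).take l) c = x l}, B,
    fun s x c => (hA s x c).inter (π.measurable_input s _ _ _), hB, fun x y c ω => ?_⟩
  have hx : ∀ {α : Type} (v : Fin n → α), (List.ofFn v).take (l + 1) =
      (List.ofFn v).take l ++ [v l] := by
    intro α v
    rw [List.take_succ_eq_append_getElem (by simp)]
    simp
  have key : π.useChannel ω l (G ω) = History.truncated (l + 1) x y c ↔
      G ω = History.truncated l x y c ∧
        π.input ω.1.1 ω.2.1.1 ((List.ofFn x).take l) c = x l ∧ ω.2.2 l (x l) = fun i => y i l := by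
    simp only [Protocol.useChannel, History.truncated, hx]
    rcases G ω with ⟨X, Y, C⟩
    simp only [History.mk.injEq, List.append_singleton_inj, funext_iff]
    constructor
    · rintro ⟨⟨rfl, h2⟩, h3, rfl⟩
      exact ⟨⟨rfl, fun i => (h3 i).1, rfl⟩, h2, fun i => h2 ▸ (h3 i).2⟩
    · rintro ⟨⟨rfl, h2, rfl⟩, h3, h4⟩
      exact ⟨⟨rfl, h3⟩, fun i => ⟨h2 i, h3.symm ▸ h4 i⟩, rfl⟩
  rw [key, hG]
  constructor
  · rintro ⟨⟨h1, h2, h3⟩, h4, h5⟩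
    refine ⟨⟨h1, h4⟩, h2, fun j hj => ?_⟩
    rcases Nat.lt_succ_iff_lt_or_eq.1 hj with hj | hj
    · exact h3 j hj
    · obtain rfl := Fin.ext hj
      exact h5
  · rintro ⟨⟨h1, h4⟩, h2, h3⟩
    exact ⟨⟨h1, h2, fun j hj => h3 j (hj.trans (Nat.lt_succ_self _))⟩, h4,
      h3 l (Nat.lt_succ_self _)⟩

theorem hasProductForm_run (π : Protocol 𝒳 𝒴 n k) : π.HasProductForm n π.run := by
  have main : ∀ l ≤ n, π.HasProductForm l (fun ω => ((List.finRange n).take l).foldl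
      (fun h (l : Fin n) => π.session ω (l.val + 1) (π.useChannel ω l h))
        (π.session ω 0 ⟨[], fun _ => [], []⟩)) := by
    intro l
    induction l with
    | zero => exact fun _ => π.hasProductForm_empty.session 0
    | succ l ih =>
      intro hl
      have := ((ih (by omega)).useChannel ⟨l, hl⟩).session (l + 1)
      rw [List.take_succ_eq_append_getElem (by simpa using hl)]
      simpa using this
  have := main n le_rfl
  rwa [List.take_of_length_le (by simp)] at this

/-- This ensures that `firstEntries n` never meets its default letter on the lists of a run, so that
lists may be exchanged for vectors without loss. -/
theorem length_run (π : Protocol 𝒳 𝒴 n k) (ω : π.Sample) :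
    (π.run ω).inputs.length = n ∧ ∀ i, ((π.run ω).outputs i).length = n := by
  have hsess : ∀ t (h : History 𝒳 𝒴), (π.session ω t h).inputs = h.inputs ∧
      (π.session ω t h).outputs = h.outputs := by
    intro t h
    unfold Protocol.session
    induction π.rounds t with
    | zero => simp
    | succ m ih =>
      rw [Function.iterate_succ_apply']
      exact ih
  have main : ∀ (L : List (Fin n)) (h : History 𝒳 𝒴),
      let h' := L.foldl (fun h (l : Fin n) => π.session ω (l.val + 1) (π.useChannel ω l h)) h
      h'.inputs.length = h.inputs.length + L.length ∧
        ∀ i, (h'.outputs i).length = (h.outputs i).length + L.length := by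
    intro L
    induction L with
    | nil => simp
    | cons l L ih =>
      intro h
      obtain ⟨h1, h2⟩ := ih (π.session ω (l.val + 1) (π.useChannel ω l h))
      obtain ⟨h3, h4⟩ := hsess (l.val + 1) (π.useChannel ω l h)
      simp only [List.foldl_cons, List.length_cons]
      refine ⟨?_, fun i => ?_⟩
      · rw [h1, h3]
        simp [Protocol.useChannel]
        omega
      · rw [h2, h4]
        simp [Protocol.useChannel]
        omega
  obtain ⟨h1, h2⟩ := main (List.finRange n) (π.session ω 0 ⟨[], fun _ => [], []⟩)
  obtain ⟨h3, h4⟩ := hsess 0 ⟨[], fun _ => [], []⟩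
  rw [h3] at h1
  rw [h4] at h2
  simpa [Protocol.run] using And.intro h1 h2

instance isProbabilityMeasure_law [Fintype 𝒳] [MeasurableSpace 𝒴]
    (π : Protocol 𝒳 𝒴 n k) (W : 𝒳 → Measure (Fin 2 → 𝒴))
    [∀ x, IsProbabilityMeasure (W x)] : IsProbabilityMeasure (π.law W) := by
  have : IsProbabilityMeasure (ProbabilityTheory.uniformOn (Set.univ :
      Set ((∀ i, Bool → Fin (k i) → Bool) × (Fin 2 → Bool)))) :=
    ProbabilityTheory.isProbabilityMeasure_uniformOn Set.finite_univ Set.univ_nonempty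
  unfold law
  infer_instance

variable [Inhabited 𝒳] [Inhabited 𝒴]

/-- The channel input sequence. -/
def sent (π : Protocol 𝒳 𝒴 n k) (ω : π.Sample) : Fin n → 𝒳 := firstEntries n (π.run ω).inputs

/-- The channel output sequences. -/
def received (π : Protocol 𝒳 𝒴 n k) (ω : π.Sample) (i : Fin 2) : Fin n → 𝒴 :=
  firstEntries n ((π.run ω).outputs i)

/-- The public transcript. -/
def transcript (π : Protocol 𝒳 𝒴 n k) (ω : π.Sample) : List ℕ := (π.run ω).pub

/-- The choice bit and the estimate of each receiver. -/
def decision (π : Protocol 𝒳 𝒴 n k) (ω : π.Sample) (i : Fin 2) : Bool × (Fin (k i) → Bool) :=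
  (π.choice i ω, π.guess i ω)

theorem run_eq (π : Protocol 𝒳 𝒴 n k) (ω : π.Sample) :
    π.run ω = History.truncated n (π.sent ω) (π.received ω) (π.transcript ω) := by
  obtain ⟨h1, h2⟩ := π.length_run ω
  have h3 : List.ofFn (π.sent ω) = (π.run ω).inputs := ofFn_firstEntries h1
  have h4 : ∀ i, List.ofFn (π.received ω i) = (π.run ω).outputs i :=
    fun i => ofFn_firstEntries (h2 i)
  have h5 : π.transcript ω = (π.run ω).pub := rfl
  simp only [History.truncated, h3, h4, h5]
  rw [List.take_of_length_le h1.le]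
  simp only [fun i => List.take_of_length_le (h2 i).le]

theorem run_eq_truncated_iff (π : Protocol 𝒳 𝒴 n k) (ω : π.Sample) (x : Fin n → 𝒳)
    (y : Fin 2 → Fin n → 𝒴) (c : List ℕ) :
    π.run ω = History.truncated n x y c ↔
      π.sent ω = x ∧ π.received ω = y ∧ π.transcript ω = c := by
  constructor
  · intro h
    refine ⟨?_, ?_, ?_⟩
    · rw [sent, h, History.truncated, List.take_of_length_le (by simp), firstEntries_ofFn]
    · funext i
      rw [received, h]
      simp only [History.truncated]
      rw [List.take_of_length_le (by simp), firstEntries_ofFn]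
    · rw [transcript, h]
      rfl
  · rintro ⟨rfl, rfl, rfl⟩
    exact π.run_eq ω

theorem outputs_eq (π : Protocol 𝒳 𝒴 n k) (ω : π.Sample) (i : Fin 2) :
    (π.run ω).outputs i = List.ofFn (π.received ω i) :=
  (ofFn_firstEntries ((π.length_run ω).2 i)).symm

theorem inputs_eq (π : Protocol 𝒳 𝒴 n k) (ω : π.Sample) :
    (π.run ω).inputs = List.ofFn (π.sent ω) :=
  (ofFn_firstEntries (π.length_run ω).1).symm

/-- The discrete data of an execution: the strings, the choice bits and estimates, the channel
inputs and outputs, and the public transcript. -/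
abbrev Outcome (𝒳 𝒴 : Type) (n : ℕ) (k : Fin 2 → ℕ) : Type :=
  (∀ i, Bool → Fin (k i) → Bool) × (∀ i, Bool × (Fin (k i) → Bool)) × (Fin n → 𝒳) ×
    (Fin 2 → Fin n → 𝒴) × List ℕ

/-- The discrete data of an execution as a random variable. -/
def outcome (π : Protocol 𝒳 𝒴 n k) (ω : π.Sample) : Outcome 𝒳 𝒴 n k :=
  (ω.1.1, π.decision ω, π.sent ω, π.received ω, π.transcript ω)

theorem exists_outcome_preimage_eq (π : Protocol 𝒳 𝒴 n k) :
    ∃ (A : (∀ i, Bool → Fin (k i) → Bool) → (Fin n → 𝒳) → List ℕ → Set π.RA)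
      (B : ∀ i, Bool × (Fin (k i) → Bool) → (Fin n → 𝒴) → List ℕ → Set (π.RB i)),
      (∀ s x c, MeasurableSet (A s x c)) ∧ (∀ i d y c, MeasurableSet (B i d y c)) ∧
      ∀ s d x y c, π.outcome ⁻¹' {(s, d, x, y, c)} =
        ({(s, fun i => (d i).1)} : Set _) ×ˢ ((A s x c ×ˢ Set.univ.pi fun i => B i (d i) (y i) c) ×ˢ
          Set.univ.pi fun j : Fin n => {f : 𝒳 → Fin 2 → 𝒴 | f (x j) = fun i => y i j}) := by
  obtain ⟨A, B, hA, hB, h⟩ := π.hasProductForm_run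
  refine ⟨A, fun i d y c => {r | r ∈ B i d.1 y c ∧ π.estimate i d.1 r (List.ofFn y) c = d.2}, hA,
    fun i d y c => (hB i d.1 y c).inter
      (π.measurable_estimate i d.1 _ _ (measurableSet_singleton _)), ?_⟩
  intro s d x y c
  ext ω
  have h' := h x y c ω
  rw [run_eq_truncated_iff] at h'
  have hg : π.run ω = History.truncated n x y c → ∀ i, π.guess i ω =
      π.estimate i (ω.1.2 i) (ω.2.1.2 i) (List.ofFn (y i)) c := by
    intro he i
    rw [guess, he]
    simp only [History.truncated]
    rw [List.take_of_length_le (by simp)]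
  rw [run_eq_truncated_iff] at hg
  simp only [outcome, Set.mem_preimage, Set.mem_singleton_iff, Prod.mk.injEq, Set.mem_prod,
    Set.mem_univ_pi, Set.mem_ofPred_eq]
  constructor
  · rintro ⟨rfl, rfl, hr⟩
    obtain ⟨h1, h2, h3⟩ := h'.1 hr
    exact ⟨Prod.ext rfl rfl, ⟨h1, fun i => ⟨h2 i, (hg hr i).symm⟩⟩, fun j => h3 j j.2⟩
  · rintro ⟨h0, ⟨h1, h2⟩, h3⟩
    obtain ⟨rfl, h0'⟩ := Prod.ext_iff.1 h0
    have hz : ∀ i, ω.1.2 i = (d i).1 := congrFun h0'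
    have hr := h'.2 ⟨h1, fun i => hz i ▸ (h2 i).1, fun j _ => h3 j⟩
    refine ⟨rfl, ?_, hr⟩
    funext i
    refine Prod.ext (hz i) ?_
    rw [← (h2 i).2, ← hz i]
    exact hg hr i

variable [Fintype 𝒳] [Finite 𝒴] [MeasurableSpace 𝒴] [MeasurableSingletonClass 𝒴]

/-- The space of outcomes is countable, so it suffices that single outcomes have measurable
preimages, and these are rectangles. All measurability questions about discrete data reduce to this.
-/
theorem measurableSet_outcome_preimage (π : Protocol 𝒳 𝒴 n k) (S : Set (Outcome 𝒳 𝒴 n k)) :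
    MeasurableSet (π.outcome ⁻¹' S) := by
  obtain ⟨A, B, hA, hB, h⟩ := π.exists_outcome_preimage_eq
  rw [← Set.biUnion_preimage_singleton]
  refine MeasurableSet.biUnion S.to_countable ?_
  rintro ⟨s, d, x, y, c⟩ -
  rw [h]
  refine (measurableSet_singleton _).prod (((hA s x c).prod (.univ_pi fun i => hB i _ _ _)).prod
    (.univ_pi fun j => ?_))
  exact measurable_pi_apply (x j) (measurableSet_singleton _)

theorem measurable_of_outcome {π : Protocol 𝒳 𝒴 n k} {β : Type} [MeasurableSpace β]
    (f : Outcome 𝒳 𝒴 n k → β) : Measurable fun ω => f (π.outcome ω) :=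
  fun S _ => π.measurableSet_outcome_preimage (f ⁻¹' S)

theorem measurable_viewA (π : Protocol 𝒳 𝒴 n k) : Measurable π.viewA := by
  have h1 : Measurable fun ω : π.Sample => (π.run ω).inputs := by
    simp only [inputs_eq]
    exact measurable_of_outcome fun o => List.ofFn o.2.2.1
  have h2 : Measurable fun ω : π.Sample => (π.run ω).pub := measurable_of_outcome fun o => o.2.2.2.2
  unfold viewA
  fun_prop

theorem measurable_viewB (π : Protocol 𝒳 𝒴 n k) (i : Fin 2) : Measurable (π.viewB i) := by
  have h1 : Measurable fun ω : π.Sample => (π.run ω).outputs i := by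
    simp only [outputs_eq]
    exact measurable_of_outcome fun o => List.ofFn (o.2.2.2.1 i)
  have h2 : Measurable fun ω : π.Sample => (π.run ω).pub := measurable_of_outcome fun o => o.2.2.2.2
  unfold viewB
  fun_prop

/-- The law of the discrete data: given the public transcript, the channel inputs and outputs, the
data of Alice and of the two receivers factor. -/
theorem exists_law_outcome_eq (π : Protocol 𝒳 𝒴 n k) :
    ∃ (a : (∀ i, Bool → Fin (k i) → Bool) → (Fin n → 𝒳) → List ℕ → ℝ≥0∞)
      (b : ∀ i, Bool × (Fin (k i) → Bool) → (Fin n → 𝒴) → List ℕ → ℝ≥0∞),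
      ∀ (W : 𝒳 → Measure (Fin 2 → 𝒴)) [∀ x, IsProbabilityMeasure (W x)], ∀ s d x y c,
        π.law W (π.outcome ⁻¹' {(s, d, x, y, c)}) =
          a s x c * (∏ i, b i (d i) (y i) c) * ∏ j, W (x j) {fun i => y i j} := by
  obtain ⟨A, B, hA, hB, h⟩ := π.exists_outcome_preimage_eq
  -- These factors are fixed before `W`, so that they are common to all channels; `a` absorbs the
  -- uniform weight of strings and choice bits.
  refine ⟨fun s x c => ((Fintype.card ((∀ i, Bool → Fin (k i) → Bool) × (Fin 2 → Bool)) : ℕ) :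
      ℝ≥0∞)⁻¹ * π.lawRA (A s x c), fun i d y c => π.lawRB i (B i d y c), ?_⟩
  intro W _ s d x y c
  have : IsProbabilityMeasure (ProbabilityTheory.uniformOn (Set.univ :
      Set ((∀ i, Bool → Fin (k i) → Bool) × (Fin 2 → Bool)))) :=
    ProbabilityTheory.isProbabilityMeasure_uniformOn Set.finite_univ Set.univ_nonempty
  have hW : ∀ j : Fin n, Measure.pi W {f : 𝒳 → Fin 2 → 𝒴 | f (x j) = fun i => y i j} =
      W (x j) {fun i => y i j} := fun j =>
    (measurePreserving_eval W (x j)).measure_preimage (measurableSet_singleton _).nullMeasurableSet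
  rw [h, law, Measure.prod_prod, Measure.prod_prod, Measure.prod_prod, Measure.pi_pi,
    Measure.pi_pi, ProbabilityTheory.uniformOn_univ, Measure.count_singleton]
  simp only [hW]
  rw [ENNReal.div_eq_inv_mul, mul_one]
  ring

end Protocol

/-! ### Small mutual information and probabilities of events -/

/-- Young's inequality: `exp a - 1` is the convex conjugate of `klFun`. -/
theorem mul_le_klFun_add {a x : ℝ} (hx : 0 ≤ x) :
    a * x ≤ InformationTheory.klFun x + (Real.exp a - 1) := by
  rw [InformationTheory.klFun_apply]
  rcases hx.eq_or_lt with rfl | hx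
  · simp [Real.exp_nonneg]
  · have h := Real.add_one_le_exp (a - Real.log x)
    rw [Real.exp_sub, Real.exp_log hx, le_div_iff₀ hx] at h
    linarith

/-- A weak form of Pinsker's inequality. -/
theorem measure_le_add_of_klDiv_le {α : Type*} [MeasurableSpace α] {μ ν : Measure α}
    [IsProbabilityMeasure μ] [IsProbabilityMeasure ν] {a : ℝ} (ha : 0 < a) (ha1 : a ≤ 1)
    (h : InformationTheory.klDiv μ ν ≤ ENNReal.ofReal (a ^ 2)) (S : Set α) :
    μ S ≤ ν S + ENNReal.ofReal (2 * a) := by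
  have hac : μ ≪ ν := by
    by_contra hac
    rw [InformationTheory.klDiv_of_not_ac hac] at h
    exact absurd h (by simp)
  rw [InformationTheory.klDiv_eq_lintegral_klFun_of_ac hac] at h
  set f := μ.rnDeriv ν
  -- Young's inequality for the density will be integrated over `S` and divided by `a`: the linear
  -- term gives `ν S`, while this square and the divergence contribute `a` each.
  have hexp : Real.exp a - 1 ≤ a + a ^ 2 := by
    have := Real.abs_exp_sub_one_sub_id_le (x := a) (by rwa [abs_of_pos ha])
    have := (abs_le.1 this).2
    linarith
  have hpt : ∀ᵐ x ∂ν, ENNReal.ofReal a * f x ≤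
      ENNReal.ofReal (InformationTheory.klFun (f x).toReal) + ENNReal.ofReal (a + a ^ 2) := by
    filter_upwards [μ.rnDeriv_lt_top ν] with x (hx : f x < ∞)
    have h1 := mul_le_klFun_add (a := a) (x := (f x).toReal) ENNReal.toReal_nonneg
    rw [← ENNReal.ofReal_add (InformationTheory.klFun_nonneg ENNReal.toReal_nonneg)
      (by positivity), ← ENNReal.ofReal_toReal hx.ne, ← ENNReal.ofReal_mul ha.le]
    exact ENNReal.ofReal_le_ofReal (by rw [ENNReal.toReal_ofReal ENNReal.toReal_nonneg]; linarith)
  have h2 : ENNReal.ofReal a * μ S ≤ ENNReal.ofReal a * (ν S + ENNReal.ofReal (2 * a)) := by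
    calc ENNReal.ofReal a * μ S = ∫⁻ x in S, ENNReal.ofReal a * f x ∂ν := by
          rw [lintegral_const_mul _ (μ.measurable_rnDeriv ν), Measure.setLIntegral_rnDeriv hac]
      _ ≤ ∫⁻ x in S, (ENNReal.ofReal (InformationTheory.klFun (f x).toReal) +
            ENNReal.ofReal (a + a ^ 2)) ∂ν := lintegral_mono_ae (ae_restrict_of_ae hpt)
      _ = ∫⁻ x in S, ENNReal.ofReal (InformationTheory.klFun (f x).toReal) ∂ν +
            ENNReal.ofReal (a + a ^ 2) * ν S := by
          rw [lintegral_add_right _ measurable_const, setLIntegral_const]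
      _ ≤ ENNReal.ofReal (a ^ 2) + ENNReal.ofReal (a + a ^ 2) * ν S := by
          gcongr
          exact (setLIntegral_le_lintegral _ _).trans h
      _ ≤ ENNReal.ofReal (a ^ 2) + (ENNReal.ofReal a * ν S + ENNReal.ofReal (a ^ 2)) := by
          rw [ENNReal.ofReal_add ha.le (by positivity), add_mul]
          gcongr
          exact mul_le_of_le_one_right' prob_le_one
      _ = ENNReal.ofReal a * (ν S + ENNReal.ofReal (2 * a)) := by
          rw [mul_add, ← ENNReal.ofReal_mul ha.le, add_left_comm,
            ← ENNReal.ofReal_add (by positivity) (by positivity)]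
          congr 2
          ring
  exact (ENNReal.mul_le_mul_iff_right (by simpa using ha) ENNReal.ofReal_ne_top).1 h2

section MutualInfo

variable {Ω α β : Type} [MeasurableSpace Ω] [MeasurableSpace α] [MeasurableSpace β]
  {P : Measure Ω} [IsProbabilityMeasure P] {S : Ω → α} {T : Ω → β} {a : ℝ}

/-- If `S` and `T` have small mutual information, then an event on both has a probability not much
larger than the greatest probability that it has for a fixed value of `T`. -/
theorem measure_le_add_of_mutualInfo_le (hS : Measurable S) (hT : Measurable T) (ha : 0 < a)
    (ha1 : a ≤ 1) (h : mutualInfo P S T ≤ ENNReal.ofReal (a ^ 2)) {E : Set (α × β)}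
    (hE : MeasurableSet E) {c : ℝ≥0∞} (hc : ∀ v, P {ω | (S ω, v) ∈ E} ≤ c) :
    P {ω | (S ω, T ω) ∈ E} ≤ c + ENNReal.ofReal (2 * a) := by
  have := Measure.isProbabilityMeasure_map (μ := P) hS.aemeasurable
  have := Measure.isProbabilityMeasure_map (μ := P) hT.aemeasurable
  have := Measure.isProbabilityMeasure_map (μ := P) (hS.prodMk hT).aemeasurable
  have h1 := measure_le_add_of_klDiv_le ha ha1 h E
  rw [Measure.map_apply (hS.prodMk hT) hE] at h1
  refine h1.trans (add_le_add_left ?_ _)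
  rw [Measure.prod_apply_symm hE]
  calc ∫⁻ v, P.map S ((fun x => (x, v)) ⁻¹' E) ∂P.map T ≤ ∫⁻ _, c ∂P.map T := by
        refine lintegral_mono fun v => ?_
        rw [Measure.map_apply hS (measurable_prodMk_right hE)]
        exact hc v
    _ = c := by simp

/-- If `S` and `T` have small mutual information, then a transformation that preserves the law of
`S` does not change the probabilities of events on `S` and `T` by much. -/
theorem measure_comp_le_add_of_mutualInfo_le (hS : Measurable S) (hT : Measurable T) (ha : 0 < a)
    (ha1 : a ≤ 1) (h : mutualInfo P S T ≤ ENNReal.ofReal (a ^ 2)) {g : α → α}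
    (hg : MeasurePreserving g (P.map S) (P.map S)) {E : Set (α × β)} (hE : MeasurableSet E) :
    P {ω | (g (S ω), T ω) ∈ E} ≤ P {ω | (S ω, T ω) ∈ E} + ENNReal.ofReal (4 * a) := by
  have := Measure.isProbabilityMeasure_map (μ := P) hS.aemeasurable
  have := Measure.isProbabilityMeasure_map (μ := P) hT.aemeasurable
  have := Measure.isProbabilityMeasure_map (μ := P) (hS.prodMk hT).aemeasurable
  have hgid : MeasurePreserving (Prod.map g id) ((P.map S).prod (P.map T))
    ((P.map S).prod (P.map T)) := hg.prod (.id _)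
  have h1 := measure_le_add_of_klDiv_le ha ha1 h (Prod.map g id ⁻¹' E)
  -- The complement yields the comparison in the opposite direction, from the product law back to
  -- the joint law.
  have h2 := measure_le_add_of_klDiv_le ha ha1 h Eᶜ
  rw [hgid.measure_preimage hE.nullMeasurableSet,
    Measure.map_apply (hS.prodMk hT) (hgid.measurable hE)] at h1
  have h3 : (P.map S).prod (P.map T) E ≤
      (P.map fun ω => (S ω, T ω)) E + ENNReal.ofReal (2 * a) := by
    rw [prob_compl_eq_one_sub hE, prob_compl_eq_one_sub hE] at h2
    have h4 := tsub_le_iff_right.1 h2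
    have h5 : (P.map S).prod (P.map T) E ≠ ∞ := measure_ne_top _ _
    refine (ENNReal.add_le_add_iff_right (a := 1 - (P.map S).prod (P.map T) E) (by simp)).1 ?_
    rw [add_tsub_cancel_of_le prob_le_one]
    calc _ ≤ _ := h4
      _ = _ := by ring
  rw [Measure.map_apply (hS.prodMk hT) hE] at h3
  refine h1.trans ((add_le_add_left h3 _).trans ?_)
  rw [add_assoc, ← ENNReal.ofReal_add (by positivity) (by positivity)]
  exact add_le_add le_rfl (ENNReal.ofReal_le_ofReal (by linarith))

end MutualInfo

/-- Overwriting some data by all elements of `β` turns each point of the fibre into `|β|` points,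
all of them different by `hg`; hence `|fibre| * |β| ≤ |α|`. -/
theorem uniformOn_preimage_singleton_le {α β : Type*} [Fintype α] [Nonempty α] [Fintype β]
    [MeasurableSpace α] [MeasurableSingletonClass α] {f : α → β} {b : β} {g : α → β → α}
    (hg : ∀ u v m m', f u = b → f v = b → g u m = g v m' → u = v ∧ m = m') :
    ProbabilityTheory.uniformOn Set.univ (f ⁻¹' {b}) ≤ (Fintype.card β : ℝ≥0∞)⁻¹ := by
  classical
  rw [ProbabilityTheory.uniformOn_univ, ← Set.Finite.coe_toFinset (Set.toFinite (f ⁻¹' {b})),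
    Measure.count_apply_finset]
  set F := (Set.toFinite (f ⁻¹' {b})).toFinset
  have hF : F.card * Fintype.card β ≤ Fintype.card α := by
    rw [← Finset.card_univ (α := β), ← Finset.card_product, ← Finset.card_univ (α := α)]
    refine Finset.card_le_card_of_injOn (fun w => g w.1 w.2) (fun _ _ => Finset.mem_coe.2
      (Finset.mem_univ _)) ?_
    rintro ⟨u, m⟩ hu ⟨v, m'⟩ hv huv
    have hu' : f u = b := by simpa [F] using hu
    have hv' : f v = b := by simpa [F] using hv
    exact Prod.ext_iff.2 (hg u v m m' hu' hv' huv)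
  have hb : 0 < Fintype.card β := Fintype.card_pos_iff.2 ⟨b⟩
  refine ENNReal.div_le_of_le_mul ?_
  rw [mul_comm, ← div_eq_mul_inv]
  rw [ENNReal.le_div_iff_mul_le (by simp [hb.ne']) (by simp)]
  exact_mod_cast hF

/-! ### Change of channel and a Chernoff bound -/

namespace Protocol

/-- The number of channel uses with an output pair in `E`. -/
def hits {𝒴 : Type} {n : ℕ} (E : Set (Fin 2 → 𝒴)) (y : Fin 2 → Fin n → 𝒴) : ℕ :=
  {j | (fun i => y i j) ∈ E}.ncard

theorem prod_indicator_eq_pow_hits {𝒴 : Type} {n : ℕ} (E : Set (Fin 2 → 𝒴))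
    [DecidablePred (· ∈ E)] (θ : ℝ≥0∞) (y : Fin 2 → Fin n → 𝒴) :
    ∏ j, (if (fun i => y i j) ∈ E then θ else 1) = θ ^ hits E y := by
  rw [hits, Set.ncard_eq_toFinset_card', Finset.prod_ite, Finset.prod_const, Finset.prod_const_one,
    mul_one]
  congr 2
  ext j
  simp

variable {𝒳 𝒴 : Type} {n : ℕ} {k : Fin 2 → ℕ} [Inhabited 𝒳] [Inhabited 𝒴] [Fintype 𝒳]
  [Finite 𝒴] [MeasurableSpace 𝒴] [MeasurableSingletonClass 𝒴]

/-- A comparison of the laws of one protocol over two channels. -/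
theorem mul_law_preimage_le (π : Protocol 𝒳 𝒴 n k) {W W' : 𝒳 → Measure (Fin 2 → 𝒴)}
    [∀ x, IsProbabilityMeasure (W x)] [∀ x, IsProbabilityMeasure (W' x)]
    {φ : (Fin 2 → 𝒴) → ℝ≥0∞} {K : ℝ≥0∞} (h : ∀ x y, φ y * W x {y} ≤ K * W' x {y})
    {S : Set (Outcome 𝒳 𝒴 n k)} {c : ℝ≥0∞}
    (hc : ∀ o ∈ S, c ≤ ∏ j, φ fun i => o.2.2.2.1 i j) :
    c * π.law W (π.outcome ⁻¹' S) ≤ K ^ n * π.law W' (π.outcome ⁻¹' S) := by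
  obtain ⟨a, b, hab⟩ := π.exists_law_outcome_eq
  -- The comparison is made outcome by outcome, where the two laws differ only in the product over
  -- the channel uses.
  have hs : ∀ V : 𝒳 → Measure (Fin 2 → 𝒴), π.law V (π.outcome ⁻¹' S) =
      ∑' o : S, π.law V (π.outcome ⁻¹' {(o : Outcome 𝒳 𝒴 n k)}) := fun V =>
    (tsum_measure_preimage_singleton S.to_countable
      fun o _ => π.measurableSet_outcome_preimage _).symm
  rw [hs, hs, ← ENNReal.tsum_mul_left, ← ENNReal.tsum_mul_left]
  refine ENNReal.tsum_le_tsum ?_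
  rintro ⟨⟨s, d, x, y, t⟩, ho⟩
  simp only [hab]
  calc c * (a s x t * (∏ i, b i (d i) (y i) t) * ∏ j, W (x j) {fun i => y i j})
      ≤ (∏ j, φ fun i => y i j) *
          (a s x t * (∏ i, b i (d i) (y i) t) * ∏ j, W (x j) {fun i => y i j}) := by
        gcongr
        exact hc _ ho
    _ = a s x t * (∏ i, b i (d i) (y i) t) *
          ∏ j, (φ (fun i => y i j) * W (x j) {fun i => y i j}) := by
        rw [Finset.prod_mul_distrib]
        ring
    _ ≤ a s x t * (∏ i, b i (d i) (y i) t) *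
          ∏ j, (K * W' (x j) {fun i => y i j}) := by
        exact mul_le_mul' le_rfl (Finset.prod_le_prod' fun j _ => h _ _)
    _ = _ := by
        rw [Finset.prod_mul_distrib, Finset.prod_const, Finset.card_univ, Fintype.card_fin]
        ring

/-- A Chernoff bound: if every channel input produces an output pair in `E` with probability `r`,
then it is exponentially unlikely that more than `n * s` output pairs are in `E`, where `r < s`. -/
theorem exists_law_hits_le (W : 𝒳 → Measure (Fin 2 → 𝒴)) [∀ x, IsProbabilityMeasure (W x)]
    (E : Set (Fin 2 → 𝒴)) {r s : ℝ} (hr : 0 ≤ r) (hr1 : r ≤ 1) (hrs : r < s)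
    (hE : ∀ x, W x E = ENNReal.ofReal r) :
    ∃ q : ℝ≥0∞, q < 1 ∧ ∀ (n : ℕ) (k : Fin 2 → ℕ) (π : Protocol 𝒳 𝒴 n k),
      π.law W {ω | (n * s : ℝ) < hits E (π.received ω)} ≤ q ^ n := by
  classical
  -- With `u ≤ 1` one has `exp u - 1 ≤ u + u ^ 2`, and then `r + u < s` gives `1 + (exp u - 1) * r ≤
  -- 1 + u * (r + u) < exp (u * s)`, which makes the ratio `κ / τ` less than 1.
  obtain ⟨u, hu0, hu1, hu2⟩ : ∃ u : ℝ, 0 < u ∧ u ≤ 1 ∧ r + u < s := by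
    refine ⟨min 1 ((s - r) / 2), ?_, min_le_left _ _, ?_⟩
    · exact lt_min one_pos (by linarith)
    · have := min_le_right 1 ((s - r) / 2)
      linarith
  set θ := ENNReal.ofReal (Real.exp u) with hθ
  set η := ENNReal.ofReal (Real.exp u - 1) with hη
  have hexp0 : 0 ≤ Real.exp u - 1 := by linarith [Real.add_one_le_exp u]
  have hθη : θ = 1 + η := by
    rw [hθ, hη, ← ENNReal.ofReal_one, ← ENNReal.ofReal_add zero_le_one hexp0]
    ring_nf
  set φ : (Fin 2 → 𝒴) → ℝ≥0∞ := fun y => if y ∈ E then θ else 1 with hφ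
  have hEm : MeasurableSet E := .of_discrete
  set κ := ENNReal.ofReal (1 + (Real.exp u - 1) * r) with hκ
  have hκ0 : κ ≠ 0 := by
    rw [hκ]
    simp only [ne_eq, ENNReal.ofReal_eq_zero, not_le]
    positivity
  have hφint : ∀ x, ∫⁻ y, φ y ∂W x = κ := by
    intro x
    have : φ = fun y => 1 + E.indicator (fun _ => η) y := by
      funext y
      by_cases hy : y ∈ E <;> simp [hφ, hy, hθη]
    rw [this, lintegral_add_left measurable_const, lintegral_indicator_const hEm, hE, hη, hκ,
      ← ENNReal.ofReal_mul hexp0, lintegral_one, measure_univ, ENNReal.ofReal_add zero_le_one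
        (by positivity), ENNReal.ofReal_one]
  -- Exponential tilting. The normalisation `κ` is the same for every input, so inputs that depend
  -- on the past do no harm; Markov's inequality becomes the bound by 1 of a probability over `W'`.
  set W' : 𝒳 → Measure (Fin 2 → 𝒴) := fun x => κ⁻¹ • (W x).withDensity φ with hW'
  have : ∀ x, IsProbabilityMeasure (W' x) := by
    intro x
    constructor
    rw [hW', Measure.smul_apply, withDensity_apply _ .univ, setLIntegral_univ, hφint, smul_eq_mul,
      ENNReal.inv_mul_cancel hκ0 ENNReal.ofReal_ne_top]
  have hcmp : ∀ x y, φ y * W x {y} ≤ κ * W' x {y} := by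
    intro x y
    rw [hW', Measure.smul_apply, withDensity_apply _ (measurableSet_singleton _),
      lintegral_singleton, smul_eq_mul, ← mul_assoc, ENNReal.mul_inv_cancel hκ0
        ENNReal.ofReal_ne_top, one_mul]
  set τ := ENNReal.ofReal (Real.exp (u * s)) with hτ
  have hτ0 : τ ≠ 0 := by
    rw [hτ]
    simp only [ne_eq, ENNReal.ofReal_eq_zero, not_le]
    positivity
  refine ⟨κ / τ, ?_, ?_⟩
  · rw [ENNReal.div_lt_iff (.inl hτ0) (.inl ENNReal.ofReal_ne_top), one_mul]
    rw [hκ, hτ, ENNReal.ofReal_lt_ofReal_iff (by positivity)]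
    have h1 := Real.add_one_le_exp (u * s)
    have h2 := (abs_le.1 (Real.abs_exp_sub_one_sub_id_le (x := u) (by rwa [abs_of_pos hu0]))).2
    nlinarith
  · intro n k π
    have hpre : {ω | (n * s : ℝ) < hits E (π.received ω)} =
        π.outcome ⁻¹' {o | (n * s : ℝ) < hits E o.2.2.2.1} := rfl
    rw [hpre]
    have hmain := π.mul_law_preimage_le hcmp (S := {o | (n * s : ℝ) < hits E o.2.2.2.1})
      (c := τ ^ n) (by
        intro o ho
        rw [prod_indicator_eq_pow_hits, hτ, hθ, ← ENNReal.ofReal_pow (by positivity),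
          ← ENNReal.ofReal_pow (by positivity), ← Real.exp_nat_mul, ← Real.exp_nat_mul]
        refine ENNReal.ofReal_le_ofReal (Real.exp_le_exp.2 ?_)
        have ho' : (n * s : ℝ) < hits E o.2.2.2.1 := ho
        nlinarith)
    rw [div_eq_mul_inv, mul_pow, ← ENNReal.inv_pow, ← div_eq_mul_inv]
    rw [ENNReal.le_div_iff_mul_le (.inl (pow_ne_zero _ hτ0))
      (.inl (ENNReal.pow_ne_top ENNReal.ofReal_ne_top)), mul_comm]
    exact hmain.trans (mul_le_of_le_one_right' prob_le_one)

end Protocol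

/-! ### Decoders and lists from conditional independence -/

section ConditionalIndependence

variable {Ω 𝒮 𝒟 τ : Type} [MeasurableSpace Ω] [Fintype 𝒮] [Fintype 𝒟] [Countable τ] {μ : Measure Ω}
  {S : Ω → 𝒮} {D : Ω → 𝒟} {T : Ω → τ} {α : τ → 𝒮 → ℝ≥0∞} {β : τ → 𝒟 → ℝ≥0∞}

theorem measure_le_mul_of_fiberwise (hT : ∀ t, MeasurableSet (T ⁻¹' {t})) {E F : Set Ω} {c : ℝ≥0∞}
    (h : ∀ t, μ (T ⁻¹' {t} ∩ E) ≤ c * μ (T ⁻¹' {t} ∩ F)) : μ E ≤ c * μ F := by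
  have hsum : ∀ G : Set Ω, μ G = ∑' t, μ (T ⁻¹' {t} ∩ G) := by
    intro G
    have := tsum_measure_preimage_singleton (μ := μ.restrict G) (Set.countable_univ (α := τ))
      (f := T) (fun t _ => hT t)
    rw [Set.preimage_univ, Measure.restrict_apply_univ,
      tsum_univ (fun t => μ.restrict G (T ⁻¹' {t}))] at this
    rw [← this]
    exact tsum_congr fun t => Measure.restrict_apply (hT t)
  rw [hsum E, hsum F, ← ENNReal.tsum_mul_left]
  exact ENNReal.tsum_le_tsum h

theorem measure_fiber_eq_sum [DecidableEq 𝒮] (hm : ∀ s d t, MeasurableSet {ω | S ω = s ∧ D ω = d ∧ T ω = t})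
    (hf : ∀ s d t, μ {ω | S ω = s ∧ D ω = d ∧ T ω = t} = α t s * β t d) (t : τ)
    (G : 𝒟 → Finset 𝒮) :
    μ (T ⁻¹' {t} ∩ {ω | S ω ∈ G (D ω)}) = ∑ d, (∑ s ∈ G d, α t s) * β t d := by
  have hE : T ⁻¹' {t} ∩ {ω | S ω ∈ G (D ω)} = ⋃ w ∈ (Finset.univ.sigma G : Finset (Σ _ : 𝒟, 𝒮)),
      {ω | S ω = w.2 ∧ D ω = w.1 ∧ T ω = t} := by
    ext ω
    simp only [Set.mem_inter_iff, Set.mem_preimage, Set.mem_singleton_iff, Set.mem_ofPred_eq,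
      Set.mem_iUnion, Finset.mem_sigma, Finset.mem_univ, true_and, exists_prop]
    constructor
    · rintro ⟨h1, h2⟩
      exact ⟨⟨D ω, S ω⟩, h2, rfl, rfl, h1⟩
    · rintro ⟨⟨d, s⟩, h1, rfl, rfl, h2⟩
      exact ⟨h2, h1⟩
  rw [hE, measure_biUnion_finset _ fun w _ => hm _ _ _, Finset.sum_sigma]
  · simp only [hf, Finset.sum_mul]
  · rintro ⟨d, s⟩ - ⟨d', s'⟩ - hne
    refine Set.disjoint_left.2 ?_
    rintro ω ⟨rfl, rfl, _⟩ ⟨rfl, rfl, _⟩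
    exact hne rfl

variable {M : Type} [Fintype M] [DecidableEq M]

/-- If `S` and `(Z, G)` are conditionally independent given `T`, then the best estimate of
`h S Z` from `Z` and `T` is at least as good as the estimate `G`. -/
theorem exists_decoder [Nonempty M] {Z : Ω → Bool} {G : Ω → M} {β : τ → Bool × M → ℝ≥0∞}
    (hT : ∀ t, MeasurableSet (T ⁻¹' {t}))
    (hm : ∀ s (d : Bool × M) t, MeasurableSet {ω | S ω = s ∧ (Z ω, G ω) = d ∧ T ω = t})
    (hf : ∀ s (d : Bool × M) t, μ {ω | S ω = s ∧ (Z ω, G ω) = d ∧ T ω = t} = α t s * β t d)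
    (h : 𝒮 → Bool → M) :
    ∃ dec : Bool → τ → M, μ {ω | G ω = h (S ω) (Z ω)} ≤ μ {ω | dec (Z ω) (T ω) = h (S ω) (Z ω)} := by
  classical
  -- The maximum a posteriori rule: given `T = t`, the values of `S` have weights `α t`, whatever
  -- `(Z, G)` is, so no `G` can do better than the heaviest value.
  choose dec hdec using fun (z : Bool) (t : τ) =>
    Finite.exists_max fun m : M => ∑ s with h s z = m, α t s
  refine ⟨dec, ?_⟩
  rw [← one_mul (μ {ω | dec (Z ω) (T ω) = h (S ω) (Z ω)})]
  refine measure_le_mul_of_fiberwise hT fun t => ?_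
  rw [one_mul]
  have h1 := measure_fiber_eq_sum hm hf t (fun d => {s | h s d.1 = d.2})
  have h2 := measure_fiber_eq_sum hm hf t (fun d => {s | h s d.1 = dec d.1 t})
  have e1 : T ⁻¹' {t} ∩ {ω | G ω = h (S ω) (Z ω)} =
      T ⁻¹' {t} ∩ {ω | S ω ∈ (Finset.univ.filter fun s => h s (Z ω) = G ω)} := by
    ext ω
    simp [eq_comm]
  have e2 : T ⁻¹' {t} ∩ {ω | dec (Z ω) (T ω) = h (S ω) (Z ω)} =
      T ⁻¹' {t} ∩ {ω | S ω ∈ (Finset.univ.filter fun s => h s (Z ω) = dec (Z ω) t)} := by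
    ext ω
    simp only [Set.mem_inter_iff, Set.mem_preimage, Set.mem_singleton_iff, Set.mem_ofPred_eq,
      Finset.mem_filter, Finset.mem_univ, true_and]
    refine and_congr_right fun ht => ?_
    rw [ht, eq_comm]
  rw [e1, e2, h1, h2]
  exact Finset.sum_le_sum fun d _ => mul_le_mul' (hdec d.1 t d.2) le_rfl

/-- If `S` and `(Z, G)` are conditionally independent given `T`, then the estimate `G` of `h S Z` is
correct with small probability, apart from a short list of likely values. -/
theorem exists_likely_values {Z : Ω → Bool} {G : Ω → M} {β : τ → Bool × M → ℝ≥0∞}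
    (hT : ∀ t, MeasurableSet (T ⁻¹' {t}))
    (hm : ∀ s (d : Bool × M) t, MeasurableSet {ω | S ω = s ∧ (Z ω, G ω) = d ∧ T ω = t})
    (hf : ∀ s (d : Bool × M) t, μ {ω | S ω = s ∧ (Z ω, G ω) = d ∧ T ω = t} = α t s * β t d)
    (h : 𝒮 → Bool → M) (θ : ℝ≥0∞) (hθ : θ ≠ 0) :
    ∃ L : τ → Finset (Bool × M), (∀ t, (L t).card * θ ≤ 2) ∧
      μ {ω | G ω = h (S ω) (Z ω) ∧ (Z ω, G ω) ∉ L (T ω)} ≤ θ * μ Set.univ := by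
  classical
  set A : τ → Bool × M → ℝ≥0∞ := fun t d => ∑ s with h s d.1 = d.2, α t s with hA
  -- The list holds the pairs of conditional probability above `θ`. For each of the two values of
  -- the bit these probabilities sum to 1, whence at most `2 / θ` pairs. The strict inequality makes
  -- the list empty if the total weight is `0` or `∞`.
  refine ⟨fun t => {d | θ * ∑ s, α t s < A t d}, fun t => ?_, ?_⟩
  · rcases (Finset.univ.filter fun d => θ * ∑ s, α t s < A t d).eq_empty_or_nonempty with he | he
    · simp [he]
    · obtain ⟨d, hd⟩ := he
      have hd' : θ * ∑ s, α t s < A t d := by simpa using hd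
      have htop : ∑ s, α t s ≠ ∞ := by
        intro h0
        rw [h0, ENNReal.mul_top hθ] at hd'
        exact not_top_lt hd'
      have hle : A t d ≤ ∑ s, α t s := Finset.sum_le_sum_of_subset (Finset.filter_subset _ _)
      have hzero : ∑ s, α t s ≠ 0 := by
        intro h0
        rw [h0] at hle hd'
        exact absurd (lt_of_lt_of_le hd' hle) not_lt_zero
      have hsum : ∑ d, A t d = 2 * ∑ s, α t s := by
        rw [Fintype.sum_prod_type, Fintype.sum_bool, two_mul]
        exact congrArg₂ _ (Finset.sum_fiberwise Finset.univ (fun s => h s true) (α t))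
          (Finset.sum_fiberwise Finset.univ (fun s => h s false) (α t))
      refine (ENNReal.mul_le_mul_iff_left hzero htop).1 ?_
      rw [← hsum, mul_assoc, ← nsmul_eq_mul]
      refine (Finset.card_nsmul_le_sum _ (A t) _ fun d hd => ?_).trans
        (Finset.sum_le_sum_of_subset (Finset.subset_univ _))
      have : θ * ∑ s, α t s < A t d := by simpa using hd
      exact this.le
  · refine measure_le_mul_of_fiberwise hT fun t => ?_
    have h1 := measure_fiber_eq_sum hm hf t
      (fun d => {s | h s d.1 = d.2 ∧ ¬ θ * ∑ s, α t s < A t d})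
    have h2 := measure_fiber_eq_sum hm hf t (fun _ => Finset.univ)
    have e1 : T ⁻¹' {t} ∩ {ω | G ω = h (S ω) (Z ω) ∧
        (Z ω, G ω) ∉ Finset.univ.filter fun d => θ * ∑ s, α (T ω) s < A (T ω) d} =
        T ⁻¹' {t} ∩ {ω | S ω ∈ (Finset.univ.filter fun s => h s (Z ω) = G ω ∧
          ¬ θ * ∑ s, α t s < A t (Z ω, G ω))} := by
      ext ω
      simp only [Set.mem_inter_iff, Set.mem_preimage, Set.mem_singleton_iff, Set.mem_ofPred_eq,
        Finset.mem_filter, Finset.mem_univ, true_and]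
      refine and_congr_right fun ht => ?_
      rw [ht, eq_comm]
    have e2 : T ⁻¹' {t} ∩ Set.univ = T ⁻¹' {t} ∩ {ω | S ω ∈ (Finset.univ : Finset 𝒮)} := by
      simp
    rw [e1, e2, h1, h2]
    refine (Finset.sum_le_sum fun d _ => ?_).trans_eq (Finset.mul_sum _ _ _).symm
    rw [← mul_assoc]
    refine mul_le_mul' ?_ le_rfl
    by_cases hd : θ * ∑ s, α t s < A t d
    · simp [hd]
    · simpa [hd] using not_lt.1 hd

end ConditionalIndependence

/-! ### Conditional independence and uniformity in a protocol -/

namespace Protocol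

variable {𝒳 𝒴 : Type} {n : ℕ} {k : Fin 2 → ℕ} [Inhabited 𝒳] [Inhabited 𝒴] [Fintype 𝒳]
  [Fintype 𝒴] [MeasurableSpace 𝒴] [MeasurableSingletonClass 𝒴]

theorem law_eq_sum (π : Protocol 𝒳 𝒴 n k) (V : 𝒳 → Measure (Fin 2 → 𝒴))
    (s : ∀ i, Bool → Fin (k i) → Bool) (c : List ℕ)
    (F : Finset (Fin n → 𝒳)) (H : Finset ((∀ i, Bool × (Fin (k i) → Bool)) × (Fin 2 → Fin n → 𝒴))) :
    π.law V {ω | ω.1.1 = s ∧ π.sent ω ∈ F ∧ (π.decision ω, π.received ω) ∈ H ∧ π.transcript ω = c} =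
      ∑ x ∈ F, ∑ w ∈ H, π.law V (π.outcome ⁻¹' {(s, w.1, x, w.2, c)}) := by
  classical
  refine Eq.trans ?_ (Finset.sum_product F H
    fun w => π.law V (π.outcome ⁻¹' {(s, w.2.1, w.1, w.2.2, c)}))
  rw [← Finset.sum_image (s := F ×ˢ H) (g := fun w => ((s, w.2.1, w.1, w.2.2, c) : Outcome 𝒳 𝒴 n k))
      (f := fun o => π.law V (π.outcome ⁻¹' {o})),
    sum_measure_preimage_singleton _ fun _ _ => π.measurableSet_outcome_preimage _]
  · congr 1
    ext ω
    simp only [Set.mem_ofPred_eq, Set.mem_preimage, Finset.coe_image, Set.mem_image,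
      Finset.mem_coe, Finset.mem_product, outcome, Prod.mk.injEq]
    constructor
    · rintro ⟨h1, h2, h3, h4⟩
      exact ⟨(π.sent ω, π.decision ω, π.received ω), ⟨h2, h3⟩, h1.symm, rfl, rfl, rfl, h4.symm⟩
    · rintro ⟨⟨x, d, y⟩, ⟨h1, h2⟩, h3, h4, h5, h6, h7⟩
      exact ⟨h3.symm, h5 ▸ h1, by rw [← h4, ← h6]; exact h2, h7.symm⟩
  · rintro ⟨x, d, y⟩ - ⟨x', d', y'⟩ - h
    simp only [Prod.mk.injEq] at h ⊢
    tauto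

/-- Given the channel inputs and the public transcript, Alice's strings are independent of what the
receivers have. -/
theorem exists_law_eq_mul_of_sent (π : Protocol 𝒳 𝒴 n k) (W : 𝒳 → Measure (Fin 2 → 𝒴))
    [∀ x, IsProbabilityMeasure (W x)] (i : Fin 2) :
    ∃ (α : (Fin n → 𝒳) × List ℕ → (∀ i, Bool → Fin (k i) → Bool) → ℝ≥0∞)
      (β : (Fin n → 𝒳) × List ℕ → Bool × (Fin (k i) → Bool) → ℝ≥0∞), ∀ s d t,
      π.law W {ω | ω.1.1 = s ∧ (π.choice i ω, π.guess i ω) = d ∧ (π.sent ω, π.transcript ω) = t} =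
        α t s * β t d := by
  classical
  obtain ⟨a, b, hab⟩ := π.exists_law_outcome_eq
  refine ⟨fun t s => a s t.1 t.2, fun t d =>
    ∑ w : (∀ i, Bool × (Fin (k i) → Bool)) × (Fin 2 → Fin n → 𝒴) with w.1 i = d,
      (∏ i, b i (w.1 i) (w.2 i) t.2) * ∏ j, W (t.1 j) {fun i => w.2 i j}, ?_⟩
  rintro s d ⟨x, c⟩
  have h := π.law_eq_sum W s c {x} {w | w.1 i = d}
  rw [Finset.sum_singleton] at h
  simp only [hab, mul_assoc] at h
  rw [← Finset.mul_sum] at h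
  rw [← h]
  congr 1
  ext ω
  simp only [Set.mem_ofPred_eq, Finset.mem_singleton, Finset.mem_filter, Finset.mem_univ, true_and,
    Prod.mk.injEq, decision]
  tauto

/-- If the channel output at Bob-`i` depends on the input only through the output at the other
receiver, then, given the channel outputs at the latter and the public transcript, Alice's strings
are independent of what Bob-`i` has. -/
theorem exists_law_eq_mul_of_received (π : Protocol 𝒳 𝒴 n k) (W : 𝒳 → Measure (Fin 2 → 𝒴))
    [∀ x, IsProbabilityMeasure (W x)] (i : Fin 2) {u : 𝒳 → 𝒴 → ℝ≥0∞} {v : 𝒴 → 𝒴 → ℝ≥0∞}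
    (hW : ∀ x y, W x {y} = u x (y i.rev) * v (y i.rev) (y i)) :
    ∃ (α : (Fin n → 𝒴) × List ℕ → (∀ i, Bool → Fin (k i) → Bool) → ℝ≥0∞)
      (β : (Fin n → 𝒴) × List ℕ → Bool × (Fin (k i) → Bool) → ℝ≥0∞), ∀ s d t,
      π.law W {ω | ω.1.1 = s ∧ (π.choice i ω, π.guess i ω) = d ∧
        (π.received ω i.rev, π.transcript ω) = t} = α t s * β t d := by
  classical
  obtain ⟨a, b, hab⟩ := π.exists_law_outcome_eq
  -- The inputs can be summed out on Alice's side alone, because they meet the outputs only through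
  -- `u`, at the other receiver's outputs `t.1`.
  refine ⟨fun t s => ∑ x, a s x t.2 * ∏ j, u (x j) (t.1 j), fun t d =>
    ∑ w : (∀ i, Bool × (Fin (k i) → Bool)) × (Fin 2 → Fin n → 𝒴) with w.1 i = d ∧ w.2 i.rev = t.1,
      (∏ i, b i (w.1 i) (w.2 i) t.2) * ∏ j, v (t.1 j) (w.2 i j), ?_⟩
  rintro s d ⟨y, c⟩
  have h := π.law_eq_sum W s c Finset.univ {w | w.1 i = d ∧ w.2 i.rev = y}
  have e : {ω | ω.1.1 = s ∧ π.sent ω ∈ (Finset.univ : Finset (Fin n → 𝒳)) ∧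
      (π.decision ω, π.received ω) ∈ Finset.univ.filter (fun w : (∀ i, Bool × (Fin (k i) → Bool)) ×
        (Fin 2 → Fin n → 𝒴) => w.1 i = d ∧ w.2 i.rev = y) ∧ π.transcript ω = c} =
      {ω | ω.1.1 = s ∧ (π.choice i ω, π.guess i ω) = d ∧
        (π.received ω i.rev, π.transcript ω) = (y, c)} := by
    ext ω
    simp only [Set.mem_ofPred_eq, Finset.mem_filter, Finset.mem_univ, true_and,
      Prod.mk.injEq, decision]
    tauto
  rw [← e, h, Finset.sum_mul_sum]
  refine Finset.sum_congr rfl fun x _ => Finset.sum_congr rfl fun w hw => ?_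
  obtain ⟨-, -, rfl⟩ := Finset.mem_filter.1 hw
  simp only [hab, hW, Finset.prod_mul_distrib]
  ring

/-! ### Uniformity of the strings and choice bits -/

theorem law_inputs_preimage (π : Protocol 𝒳 𝒴 n k) (W : 𝒳 → Measure (Fin 2 → 𝒴))
    [∀ x, IsProbabilityMeasure (W x)]
    (S : Set ((∀ i, Bool → Fin (k i) → Bool) × (Fin 2 → Bool))) :
    π.law W {ω | ω.1 ∈ S} = ProbabilityTheory.uniformOn Set.univ S := by
  have : IsProbabilityMeasure (ProbabilityTheory.uniformOn (Set.univ :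
      Set ((∀ i, Bool → Fin (k i) → Bool) × (Fin 2 → Bool)))) :=
    ProbabilityTheory.isProbabilityMeasure_uniformOn Set.finite_univ Set.univ_nonempty
  exact measurePreserving_fst.measure_preimage MeasurableSet.of_discrete.nullMeasurableSet

theorem law_unchosen_le (π : Protocol 𝒳 𝒴 n k) (W : 𝒳 → Measure (Fin 2 → 𝒴))
    [∀ x, IsProbabilityMeasure (W x)] (m : ∀ i, Fin (k i) → Bool) :
    π.law W {ω | (fun i => π.unchosen i ω) = m} ≤ ((2 : ℝ≥0∞) ^ (k 0 + k 1))⁻¹ := by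
  have h := uniformOn_preimage_singleton_le
    (f := fun w : (∀ i, Bool → Fin (k i) → Bool) × (Fin 2 → Bool) => fun i => w.1 i (!w.2 i))
    (b := m) (g := fun w m' => (fun i b => if b = w.2 i then w.1 i b else m' i, w.2)) (by
      rintro ⟨s, z⟩ ⟨s', z'⟩ m₁ m₂ hu hv h
      obtain ⟨h1, rfl⟩ := Prod.ext_iff.1 h
      have h2 : ∀ i b, (if b = z i then s i b else m₁ i) = if b = z i then s' i b else m₂ i :=
        fun i b => congrFun (congrFun h1 i) b
      refine ⟨Prod.ext ?_ rfl, ?_⟩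
      · funext i b
        by_cases hb : b = z i
        · simpa [hb] using h2 i b
        · obtain rfl : b = !z i := by
            cases b <;> cases hz : z i <;> simp_all
          exact (congrFun hu i).trans (congrFun hv i).symm
      · funext i
        simpa using h2 i (!z i))
  rw [← π.law_inputs_preimage W] at h
  refine h.trans (le_of_eq ?_)
  simp [Fintype.card_pi, Fin.prod_univ_two, pow_add]

theorem law_choice_string_le (π : Protocol 𝒳 𝒴 n k) (W : 𝒳 → Measure (Fin 2 → 𝒴))
    [∀ x, IsProbabilityMeasure (W x)] (i : Fin 2) (d : Bool × (Fin (k i) → Bool)) :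
    π.law W {ω | (π.choice i ω, π.chosen i ω) = d} ≤ (2 * (2 : ℝ≥0∞) ^ k i)⁻¹ := by
  have h := uniformOn_preimage_singleton_le
    (f := fun w : (∀ i, Bool → Fin (k i) → Bool) × (Fin 2 → Bool) => (w.2 i, w.1 i (w.2 i)))
    (b := d) (g := fun w m => (Function.update w.1 i (Function.update (w.1 i) (w.2 i) m.2),
      Function.update w.2 i m.1)) (by
      rintro ⟨s, z⟩ ⟨s', z'⟩ ⟨b₁, m₁⟩ ⟨b₂, m₂⟩ hu hv h
      have huv := hu.trans hv.symm
      simp only [Prod.mk.injEq] at huv h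
      obtain ⟨hz, hs⟩ := huv
      obtain ⟨h1, h2⟩ := h
      have h3 := congrFun h1 i
      simp only [Function.update_self] at h3
      have h4 := congrFun h2 i
      simp only [Function.update_self] at h4
      refine ⟨Prod.ext ?_ ?_, Prod.ext h4 ?_⟩
      · funext j
        by_cases hj : j = i
        · subst hj
          funext b
          by_cases hb : b = z j
          · subst hb
            change s j (z j) = s' j (z j)
            rw [hs, hz]
          · have := congrFun h3 b
            rwa [Function.update_of_ne hb, Function.update_of_ne (hz ▸ hb)] at this
        · have := congrFun h1 j
          rwa [Function.update_of_ne hj, Function.update_of_ne hj] at this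
      · funext j
        by_cases hj : j = i
        · subst hj
          exact hz
        · have := congrFun h2 j
          rwa [Function.update_of_ne hj, Function.update_of_ne hj] at this
      · have := congrFun h3 (z i)
        rwa [Function.update_self, hz, Function.update_self] at this)
  rw [← π.law_inputs_preimage W] at h
  refine h.trans (le_of_eq ?_)
  simp

theorem measurePreserving_not_choice (π : Protocol 𝒳 𝒴 n k) (W : 𝒳 → Measure (Fin 2 → 𝒴))
    [∀ x, IsProbabilityMeasure (W x)] (i : Fin 2) :
    MeasurePreserving not ((π.law W).map (π.choice i)) ((π.law W).map (π.choice i)) := by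
  have hmeas : Measurable (π.choice i) := by
    unfold choice
    fun_prop
  have hprob := Measure.isProbabilityMeasure_map (μ := π.law W) hmeas.aemeasurable
  have hle : ∀ b, (π.law W).map (π.choice i) {b} ≤ 2⁻¹ := by
    intro b
    have h := uniformOn_preimage_singleton_le
      (f := fun w : (∀ i, Bool → Fin (k i) → Bool) × (Fin 2 → Bool) => w.2 i)
      (b := b) (g := fun w m => (w.1, Function.update w.2 i m)) (by
        rintro ⟨s, z⟩ ⟨s', z'⟩ b₁ b₂ hu hv h
        obtain ⟨rfl, h2⟩ := Prod.ext_iff.1 h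
        refine ⟨Prod.ext rfl ?_, by simpa using congrFun h2 i⟩
        funext j
        by_cases hj : j = i
        · subst hj
          exact hu.trans hv.symm
        · simpa [hj] using congrFun h2 j)
    rw [← π.law_inputs_preimage W, Fintype.card_bool] at h
    rw [Measure.map_apply hmeas (measurableSet_singleton _)]
    exact_mod_cast h
  have hsum : (π.law W).map (π.choice i) {false} + (π.law W).map (π.choice i) {true} = 1 := by
    rw [← measure_union (by simp) (measurableSet_singleton _), ← hprob.measure_univ]
    congr 1
    ext b
    cases b <;> simp
  have heq : (π.law W).map (π.choice i) {false} = (π.law W).map (π.choice i) {true} := by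
    have h1 := hle false
    have h2 := hle true
    have h3 : ∀ p q : ℝ≥0∞, p ≤ 2⁻¹ → q ≤ 2⁻¹ → p + q = 1 → p = 2⁻¹ := by
      intro p q hp hq hpq
      refine le_antisymm hp ?_
      rw [← ENNReal.add_le_add_iff_right (a := 2⁻¹) (by simp), ENNReal.inv_two_add_inv_two, ← hpq]
      gcongr
    rw [h3 _ _ h1 h2 hsum, h3 _ _ h2 h1 (by rw [add_comm]; exact hsum)]
  refine ⟨.of_discrete, Measure.ext_of_singleton fun b => ?_⟩
  rw [Measure.map_apply .of_discrete (measurableSet_singleton _)]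
  cases b
  · rw [show not ⁻¹' {false} = {true} by ext b; simp, heq]
  · rw [show not ⁻¹' {true} = {false} by ext b; simp, heq]

end Protocol

/-! ### Erasure channels and the degraded comparison channel -/

theorem prod_fin_two_eq_mul_rev {M : Type*} [CommMonoid M] (f : Fin 2 → M) (i : Fin 2) :
    ∏ j, f j = f i * f i.rev := by
  rw [Fin.prod_univ_two]
  fin_cases i
  · rfl
  · exact mul_comm _ _

theorem bec_singleton_none (p : ℝ) (x : Bool) : bec p x {none} = ENNReal.ofReal p := by
  simp [bec]

theorem bec_singleton_some (p : ℝ) (x b : Bool) :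
    bec p x {some b} = if b = x then ENNReal.ofReal (1 - p) else 0 := by
  simp [bec, eq_comm, Set.indicator_apply]

theorem isProbabilityMeasure_bec {p : ℝ} (hp : p ∈ Set.Icc (0 : ℝ) 1) (x : Bool) :
    IsProbabilityMeasure (bec p x) := by
  constructor
  simp only [bec, Measure.add_apply, Measure.smul_apply, measure_univ, smul_eq_mul, mul_one]
  rw [← ENNReal.ofReal_add (by linarith [hp.2]) hp.1]
  simp

theorem isProbabilityMeasure_independentBEC {p : Fin 2 → ℝ} (hp : ∀ i, p i ∈ Set.Icc (0 : ℝ) 1)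
    (x : Bool) : IsProbabilityMeasure (independentBEC p x) := by
  have := fun i => isProbabilityMeasure_bec (hp i) x
  unfold independentBEC
  infer_instance

theorem independentBEC_pi {p : Fin 2 → ℝ} (hp : ∀ i, p i ∈ Set.Icc (0 : ℝ) 1) (x : Bool)
    (i : Fin 2) (S : Fin 2 → Set (Option Bool)) :
    independentBEC p x (Set.univ.pi S) = bec (p i) x (S i) * bec (p i.rev) x (S i.rev) := by
  have := fun i => isProbabilityMeasure_bec (hp i) x
  rw [independentBEC, Measure.pi_pi, prod_fin_two_eq_mul_rev _ i]

theorem independentBEC_singleton {p : Fin 2 → ℝ} (hp : ∀ i, p i ∈ Set.Icc (0 : ℝ) 1) (x : Bool)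
    (i : Fin 2) (y : Fin 2 → Option Bool) :
    independentBEC p x {y} = bec (p i) x {y i} * bec (p i.rev) x {y i.rev} := by
  rw [← Set.univ_pi_singleton, independentBEC_pi hp x i]

/-- The event that both outputs are erased. -/
def bothErased : Set (Fin 2 → Option Bool) := {fun _ => none}

/-- The event that the output at the other receiver than Bob-`i` alone is erased. -/
def onlyOtherErased (i : Fin 2) : Set (Fin 2 → Option Bool) := {y | y i ≠ none ∧ y i.rev = none}

theorem independentBEC_bothErased {p : Fin 2 → ℝ} (hp : ∀ i, p i ∈ Set.Icc (0 : ℝ) 1) (x : Bool) :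
    independentBEC p x bothErased = ENNReal.ofReal (p 0 * p 1) := by
  rw [bothErased, independentBEC_singleton hp x 0, bec_singleton_none, bec_singleton_none,
    ENNReal.ofReal_mul (hp 0).1]
  rfl

theorem independentBEC_onlyOtherErased {p : Fin 2 → ℝ} (hp : ∀ i, p i ∈ Set.Icc (0 : ℝ) 1)
    (i : Fin 2) (x : Bool) :
    independentBEC p x (onlyOtherErased i) = ENNReal.ofReal (p i.rev * (1 - p i)) := by
  have hne : i.rev ≠ i := by fin_cases i <;> decide
  have hE : onlyOtherErased i = Set.univ.pi fun j => if j = i then {none}ᶜ else {none} := by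
    ext y
    simp only [onlyOtherErased, Set.mem_ofPred_eq, Set.mem_univ_pi]
    constructor
    · rintro ⟨h1, h2⟩ j
      by_cases hj : j = i
      · subst hj
        simpa using h1
      · obtain rfl : j = i.rev := by
          revert hj
          fin_cases i <;> fin_cases j <;> simp
        simpa [hne] using h2
    · intro h
      refine ⟨by simpa using h i, by simpa [hne] using h i.rev⟩
  have := isProbabilityMeasure_bec (hp i) x
  rw [hE, independentBEC_pi hp x i, if_pos rfl, if_neg hne, bec_singleton_none,
    prob_compl_eq_one_sub (measurableSet_singleton _), bec_singleton_none,
    ← ENNReal.ofReal_one, ← ENNReal.ofReal_sub _ (hp i).1, mul_comm, ENNReal.ofReal_mul (hp i.rev).1]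

/-- The law of the output of a binary erasure channel with erasure probability `p` when the input is
uniform, except that it is known if `o` is not an erasure. -/
def becGiven (p : ℝ) (o : Option Bool) : Measure (Option Bool) :=
  o.elim ((2⁻¹ : ℝ≥0∞) • (bec p false + bec p true)) (bec p)

theorem isProbabilityMeasure_becGiven {p : ℝ} (hp : p ∈ Set.Icc (0 : ℝ) 1) (o : Option Bool) :
    IsProbabilityMeasure (becGiven p o) := by
  have := fun x => isProbabilityMeasure_bec hp x
  cases o with
  | some b => exact this b
  | none =>
    constructor
    simp only [becGiven, Option.elim_none, Measure.smul_apply, Measure.add_apply, measure_univ,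
      smul_eq_mul, one_add_one_eq_two]
    exact ENNReal.inv_mul_cancel (by simp) (by simp)

/-- The broadcast channel in which the output at Bob-`i` is generated from the output at the other
receiver. -/
def degradedBEC (p : Fin 2 → ℝ) (i : Fin 2) (x : Bool) : Measure (Fin 2 → Option Bool) :=
  ∑ y : Fin 2 → Option Bool,
    (bec (p i.rev) x {y i.rev} * becGiven (p i) (y i.rev) {y i}) • Measure.dirac y

theorem degradedBEC_singleton (p : Fin 2 → ℝ) (i : Fin 2) (x : Bool) (y : Fin 2 → Option Bool) :
    degradedBEC p i x {y} = bec (p i.rev) x {y i.rev} * becGiven (p i) (y i.rev) {y i} := by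
  rw [degradedBEC, Measure.finsetSum_apply, Finset.sum_eq_single y]
  · simp
  · intro z _ hz
    simp [hz]
  · simp

theorem isProbabilityMeasure_degradedBEC {p : Fin 2 → ℝ} (hp : ∀ i, p i ∈ Set.Icc (0 : ℝ) 1)
    (i : Fin 2) (x : Bool) : IsProbabilityMeasure (degradedBEC p i x) := by
  have h1 := isProbabilityMeasure_bec (hp i.rev) x
  have h2 := fun o => isProbabilityMeasure_becGiven (hp i) o
  have hsum : ∀ ν : Measure (Option Bool), ∑ o, ν {o} = ν Set.univ := by
    intro ν
    rw [← Finset.coe_univ, sum_measure_singleton]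
  constructor
  rw [degradedBEC, Measure.finsetSum_apply]
  simp only [Measure.smul_apply, measure_univ, smul_eq_mul, mul_one]
  have hpair : ∀ f : Option Bool → Option Bool → ℝ≥0∞,
      ∑ y : Fin 2 → Option Bool, f (y i.rev) (y i) = ∑ u, ∑ v, f u v := by
    intro f
    rw [← (finTwoArrowEquiv (Option Bool)).symm.sum_comp, Fintype.sum_prod_type]
    fin_cases i
    · exact Finset.sum_comm
    · rfl
  rw [hpair fun u v => bec (p i.rev) x {u} * becGiven (p i) u {v}]
  simp only [← Finset.mul_sum, hsum, measure_univ, mul_one]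

/-- An unerased output at the other receiver reveals the input, and an erasure at Bob-`i` does not
depend on it. Otherwise the degraded channel has to guess the input, and is right half of the time;
this is the only loss. -/
theorem independentBEC_le_degradedBEC {p : Fin 2 → ℝ} (hp : ∀ i, p i ∈ Set.Icc (0 : ℝ) 1)
    (i : Fin 2) [DecidablePred (· ∈ onlyOtherErased i)] (x : Bool) (y : Fin 2 → Option Bool) :
    (if y ∈ onlyOtherErased i then 2⁻¹ else 1) * independentBEC p x {y} ≤
      1 * degradedBEC p i x {y} := by
  rw [one_mul, independentBEC_singleton hp x i, degradedBEC_singleton, mul_comm (bec (p i) x _),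
    mul_left_comm]
  rcases hr : y i.rev with _ | b
  · refine mul_le_mul' le_rfl ?_
    rcases hi : y i with _ | c
    · rw [if_neg (by simp [onlyOtherErased, hi]), one_mul]
      simp only [becGiven, Option.elim_none, Measure.smul_apply, Measure.add_apply,
        bec_singleton_none, smul_eq_mul]
      rw [← two_mul, ← mul_assoc, ENNReal.inv_mul_cancel (by simp) (by simp), one_mul]
    · rw [if_pos (by simp [onlyOtherErased, hi, hr])]
      simp only [becGiven, Option.elim_none, Measure.smul_apply, Measure.add_apply, smul_eq_mul]
      gcongr
      cases x
      · exact le_self_add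
      · exact le_add_self
  · rw [if_neg (by simp [onlyOtherErased, hr]), one_mul]
    rw [bec_singleton_some]
    by_cases hb : b = x
    · subst hb
      rfl
    · simp [hb]

/-! ### The two converses for a single protocol -/

namespace Protocol

variable {n : ℕ} {k : Fin 2 → ℕ}

theorem measurable_choice (π : Protocol Bool (Option Bool) n k) (i : Fin 2) :
    Measurable (π.choice i) := by
  unfold choice
  fun_prop

/-- The converse against one receiver: the string that Bob-`i` obtains is a secret from the other
receiver, and so it is not much longer than the number of times that the channel output is erased at
the other receiver only. -/
theorem one_le_of_secure_single {p : Fin 2 → ℝ} (hp : ∀ i, p i ∈ Set.Icc (0 : ℝ) 1)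
    (π : Protocol Bool (Option Bool) n k) (i : Fin 2) {a : ℝ} (ha : 0 < a) (ha1 : a ≤ 1)
    (h : mutualInfo (π.law (independentBEC p))
      (fun ω => (π.string i false ω, π.string i true ω, π.unchosen i.rev ω, π.choice i ω))
      (π.viewB i.rev) ≤ ENNReal.ofReal (a ^ 2)) (N : ℕ) :
    1 ≤ π.law (independentBEC p) {ω | π.guess i ω ≠ π.chosen i ω} +
      π.law (independentBEC p) {ω | N < hits (onlyOtherErased i) (π.received ω)} +
      (4⁻¹ + ENNReal.ofReal (2 * a)) + 2 ^ N * (4 * (2 ^ k i)⁻¹) := by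
  classical
  have := isProbabilityMeasure_independentBEC hp
  have := isProbabilityMeasure_degradedBEC hp i
  obtain ⟨α, β, hf⟩ := π.exists_law_eq_mul_of_received (degradedBEC p i) i
    (u := fun x o => bec (p i.rev) x {o}) (v := fun o o' => becGiven (p i) o {o'})
    (degradedBEC_singleton p i)
  have hk : (4 : ℝ≥0∞) * (2 ^ k i)⁻¹ ≠ 0 := by simp
  -- With this threshold the list has at most `2 ^ k i / 2` elements, a quarter of the `2 * 2 ^ k i`
  -- equiprobable values of choice bit and chosen string.
  obtain ⟨L, hL, hQ⟩ := exists_likely_values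
    (fun t => π.measurableSet_outcome_preimage {o | (o.2.2.2.1 i.rev, o.2.2.2.2) = t})
    (fun s d t => π.measurableSet_outcome_preimage
      {o | o.1 = s ∧ o.2.1 i = d ∧ (o.2.2.2.1 i.rev, o.2.2.2.2) = t}) hf
    (fun s z => s i z) (4 * (2 ^ k i)⁻¹) hk
  rw [measure_univ, mul_one] at hQ
  have hlist : π.law (independentBEC p)
      {ω | (π.choice i ω, π.chosen i ω) ∈ L (π.received ω i.rev, π.transcript ω)} ≤
        4⁻¹ + ENNReal.ofReal (2 * a) := by
    have hS : Measurable fun ω : π.Sample =>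
        (π.string i false ω, π.string i true ω, π.unchosen i.rev ω, π.choice i ω) :=
      measurable_of_outcome fun o : Outcome Bool (Option Bool) n k =>
        (o.1 i false, o.1 i true, o.1 i.rev (!(o.2.1 i.rev).1), (o.2.1 i).1)
    have hE : MeasurableSet {w : ((Fin (k i) → Bool) × (Fin (k i) → Bool) ×
        (Fin (k i.rev) → Bool) × Bool) × (Bool × π.RB i.rev × List (Option Bool) × List ℕ) |
        (w.1.2.2.2, if w.1.2.2.2 then w.1.2.1 else w.1.1) ∈
          L (firstEntries n w.2.2.2.1, w.2.2.2.2)} := by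
      have hm : Measurable fun w : ((Fin (k i) → Bool) × (Fin (k i) → Bool) ×
          (Fin (k i.rev) → Bool) × Bool) × (Bool × π.RB i.rev × List (Option Bool) × List ℕ) =>
          (w.1, w.2.2.2) := by fun_prop
      exact hm (MeasurableSet.of_discrete (s := {w | (w.1.2.2.2, if w.1.2.2.2 then w.1.2.1 else
        w.1.1) ∈ L (firstEntries n w.2.1, w.2.2)}))
    have hchosen : ∀ ω, (if π.choice i ω then π.string i true ω else π.string i false ω) =
        π.chosen i ω := by
      intro ω
      rw [chosen]
      cases π.choice i ω <;> rfl
    have := measure_le_add_of_mutualInfo_le hS (π.measurable_viewB i.rev) ha ha1 h hE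
      (c := 4⁻¹) (by
        intro v
        simp only [Set.mem_ofPred_eq, hchosen]
        set F := L (firstEntries n v.2.2.1, v.2.2.2) with hF
        calc π.law (independentBEC p) {ω | (π.choice i ω, π.chosen i ω) ∈ F}
            ≤ ∑ d ∈ F, π.law (independentBEC p) {ω | (π.choice i ω, π.chosen i ω) = d} := by
              refine (measure_mono fun ω hω => ?_).trans (measure_biUnion_finset_le F _)
              simpa using hω
          _ ≤ ∑ d ∈ F, (2 * (2 : ℝ≥0∞) ^ k i)⁻¹ :=
              Finset.sum_le_sum fun d _ => π.law_choice_string_le _ i d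
          _ = F.card * (4 * (2 ^ k i)⁻¹) * 8⁻¹ := by
              rw [Finset.sum_const, nsmul_eq_mul, ENNReal.mul_inv (by simp) (by simp), mul_assoc]
              congr 1
              rw [mul_right_comm]
              congr 1
              rw [show (8 : ℝ≥0∞) = 4 * 2 by norm_num, ENNReal.mul_inv (by simp) (by simp),
                ← mul_assoc, ENNReal.mul_inv_cancel (by simp) (by simp), one_mul]
          _ ≤ 2 * 8⁻¹ := by
              gcongr
              exact hL _
          _ = 4⁻¹ := by
              rw [show (8 : ℝ≥0∞) = 2 * 4 by norm_num, ENNReal.mul_inv (by simp) (by simp),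
                ← mul_assoc, ENNReal.mul_inv_cancel (by simp) (by simp), one_mul])
    simp only [Set.mem_ofPred_eq, hchosen] at this
    exact this
  -- A correct guess off the list, with few positions erased at the other receiver only: rare over
  -- the degraded channel, hence at most `2 ^ N` times as likely over the true one.
  set B : Set (Outcome Bool (Option Bool) n k) := {o | ((o.2.1 i).2 = o.1 i (o.2.1 i).1 ∧
    o.2.1 i ∉ L (o.2.2.2.1 i.rev, o.2.2.2.2)) ∧ hits (onlyOtherErased i) o.2.2.2.1 ≤ N} with hB
  have hPB : π.law (independentBEC p) (π.outcome ⁻¹' B) ≤ 2 ^ N * (4 * (2 ^ k i)⁻¹) := by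
    have h1 := π.mul_law_preimage_le (independentBEC_le_degradedBEC hp i) (S := B) (c := 2⁻¹ ^ N)
      (by
        intro o ho
        rw [prod_indicator_eq_pow_hits]
        exact pow_le_pow_right_of_le_one' (by simp) ho.2)
    rw [one_pow, one_mul] at h1
    have h2 : π.law (degradedBEC p i) (π.outcome ⁻¹' B) ≤ 4 * (2 ^ k i)⁻¹ :=
      (measure_mono fun ω hω => hω.1).trans hQ
    have h3 := h1.trans h2
    calc π.law (independentBEC p) (π.outcome ⁻¹' B)
        = 2 ^ N * (2⁻¹ ^ N * π.law (independentBEC p) (π.outcome ⁻¹' B)) := by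
          rw [← mul_assoc, ← mul_pow, ENNReal.mul_inv_cancel (by simp) (by simp), one_pow, one_mul]
      _ ≤ _ := by gcongr
  calc (1 : ℝ≥0∞) = π.law (independentBEC p) Set.univ := measure_univ.symm
    _ ≤ π.law (independentBEC p) ({ω | π.guess i ω ≠ π.chosen i ω} ∪
          {ω | N < hits (onlyOtherErased i) (π.received ω)} ∪
          {ω | (π.choice i ω, π.chosen i ω) ∈ L (π.received ω i.rev, π.transcript ω)} ∪
          π.outcome ⁻¹' B) := by
        refine measure_mono fun ω _ => ?_
        by_cases h1 : π.guess i ω = π.chosen i ω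
        · by_cases h2 : N < hits (onlyOtherErased i) (π.received ω)
          · exact .inl (.inl (.inr h2))
          · by_cases h3 : (π.choice i ω, π.chosen i ω) ∈ L (π.received ω i.rev, π.transcript ω)
            · exact .inl (.inr h3)
            · refine .inr ⟨⟨h1, ?_⟩, not_lt.1 h2⟩
              rw [← h1] at h3
              exact h3
        · exact .inl (.inl (.inl h1))
    _ ≤ _ := by
        refine (measure_union_le _ _).trans (add_le_add ?_ hPB)
        refine (measure_union_le _ _).trans (add_le_add ?_ hlist)
        exact measure_union_le _ _

/-- The string that Bob-`i` does not choose can be decoded from his choice bit, the channel inputs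
and the public transcript, since Alice must not know which of the strings he can decode. -/
theorem exists_decoder_unchosen {p : Fin 2 → ℝ} (hp : ∀ i, p i ∈ Set.Icc (0 : ℝ) 1)
    (π : Protocol Bool (Option Bool) n k) (i : Fin 2) {a : ℝ} (ha : 0 < a) (ha1 : a ≤ 1)
    (h : mutualInfo (π.law (independentBEC p)) (π.choice i) (fun ω => (π.viewA ω, π.viewB i.rev ω))
      ≤ ENNReal.ofReal (a ^ 2)) :
    ∃ dec : Bool → (Fin n → Bool) × List ℕ → (Fin (k i) → Bool),
      π.law (independentBEC p)
        {ω | dec (!π.choice i ω) (π.sent ω, π.transcript ω) ≠ π.unchosen i ω} ≤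
      π.law (independentBEC p) {ω | π.guess i ω ≠ π.chosen i ω} + ENNReal.ofReal (4 * a) := by
  classical
  have := isProbabilityMeasure_independentBEC hp
  obtain ⟨α, β, hf⟩ := π.exists_law_eq_mul_of_sent (independentBEC p) i
  obtain ⟨dec, hdec⟩ := exists_decoder
    (fun t => π.measurableSet_outcome_preimage {o | (o.2.2.1, o.2.2.2.2) = t})
    (fun s d t => π.measurableSet_outcome_preimage
      {o | o.1 = s ∧ o.2.1 i = d ∧ (o.2.2.1, o.2.2.2.2) = t}) hf (fun s z => s i z)
  refine ⟨dec, ?_⟩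
  have hE : MeasurableSet {w : Bool × (((∀ i, Bool → Fin (k i) → Bool) × π.RA × List Bool × List ℕ) ×
      (Bool × π.RB i.rev × List (Option Bool) × List ℕ)) |
      dec w.1 (firstEntries n w.2.1.2.2.1, w.2.1.2.2.2) ≠ w.2.1.1 i w.1} := by
    have hm : Measurable fun w : Bool × (((∀ i, Bool → Fin (k i) → Bool) × π.RA × List Bool ×
        List ℕ) × (Bool × π.RB i.rev × List (Option Bool) × List ℕ)) =>
        (w.1, w.2.1.1, w.2.1.2.2) := by fun_prop
    exact hm (MeasurableSet.of_discrete (s := {w | dec w.1 (firstEntries n w.2.2.1, w.2.2.2) ≠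
      w.2.1 i w.1}))
  -- The event is a decoding error for the string labelled by the given bit. Apart from this bit it
  -- involves only Alice's view, so flipping the choice bit hardly changes its probability.
  have h1 := measure_comp_le_add_of_mutualInfo_le (π.measurable_choice i)
    (π.measurable_viewA.prodMk (π.measurable_viewB i.rev)) ha ha1 h
    (π.measurePreserving_not_choice _ i) hE
  refine h1.trans (add_le_add ?_ le_rfl)
  have h2 : MeasurableSet {ω | π.guess i ω = π.chosen i ω} :=
    π.measurableSet_outcome_preimage {o | (o.2.1 i).2 = o.1 i (o.2.1 i).1}
  have h3 : MeasurableSet {ω | dec (π.choice i ω) (π.sent ω, π.transcript ω) = π.chosen i ω} :=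
    π.measurableSet_outcome_preimage
      {o | dec (o.2.1 i).1 (o.2.2.1, o.2.2.2.2) = o.1 i (o.2.1 i).1}
  have h4 := tsub_le_tsub_left hdec 1
  have h5 := (prob_compl_eq_one_sub (μ := π.law (independentBEC p)) h3).trans_le
    (h4.trans_eq (prob_compl_eq_one_sub (μ := π.law (independentBEC p)) h2).symm)
  exact h5

/-- The input `x` is possible with the outputs `y`. -/
def Compatible (x : Bool) (y : Fin 2 → Option Bool) : Prop := ∀ i, y i = none ∨ y i = some x

theorem law_not_compatible {p : Fin 2 → ℝ} (hp : ∀ i, p i ∈ Set.Icc (0 : ℝ) 1)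
    (π : Protocol Bool (Option Bool) n k) :
    π.law (independentBEC p)
      {ω | ∃ j, ¬ Compatible (π.sent ω j) fun i => π.received ω i j} = 0 := by
  have := isProbabilityMeasure_independentBEC hp
  obtain ⟨a, b, hab⟩ := π.exists_law_outcome_eq
  change π.law (independentBEC p) (π.outcome ⁻¹'
    {o | ∃ j, ¬ Compatible (o.2.2.1 j) fun i => o.2.2.2.1 i j}) = 0
  rw [← Set.biUnion_preimage_singleton, measure_biUnion_null_iff (Set.to_countable _)]
  rintro ⟨s, d, x, y, c⟩ ⟨j, hj⟩
  rw [hab]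
  refine mul_eq_zero_of_right _ (Finset.prod_eq_zero (Finset.mem_univ j) ?_)
  simp only [Compatible, not_forall, not_or] at hj
  obtain ⟨i, h1, h2⟩ := hj
  rw [independentBEC_singleton hp _ i]
  obtain ⟨b, hb⟩ := Option.ne_none_iff_exists'.1 h1
  simp only [hb] at h2 ⊢
  rw [bec_singleton_some, if_neg (by simpa using h2), zero_mul]

/-- One unerased output determines the input letter, so only positions erased at both receivers
leave two possibilities. -/
theorem card_compatible_le (y : Fin 2 → Fin n → Option Bool)
    [DecidablePred fun x : Fin n → Bool => ∀ j, Compatible (x j) fun i => y i j] :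
    (Finset.univ.filter fun x : Fin n → Bool => ∀ j, Compatible (x j) fun i => y i j).card ≤
      2 ^ hits bothErased y := by
  classical
  have h1 : (Finset.univ.filter fun x : Fin n → Bool => ∀ j, Compatible (x j) fun i => y i j) =
      Fintype.piFinset fun j => Finset.univ.filter fun b => Compatible b fun i => y i j := by
    ext x
    simp
  have h2 := prod_indicator_eq_pow_hits bothErased 2 y
  rw [h1, Fintype.card_piFinset]
  have h3 : ((∏ j, (Finset.univ.filter fun b => Compatible b fun i => y i j).card : ℕ) : ℝ≥0∞) ≤
      2 ^ hits bothErased y := by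
    rw [← h2, Nat.cast_prod]
    refine Finset.prod_le_prod' fun j _ => ?_
    split_ifs with hj
    · exact_mod_cast (Finset.card_le_univ _).trans_eq Fintype.card_bool
    · have : ∃ i, y i j ≠ none := by
        by_contra! hc
        exact hj (funext hc)
      obtain ⟨i, hi⟩ := this
      have hle : (Finset.univ.filter fun b => Compatible b fun i => y i j).card ≤ 1 := by
        refine Finset.card_le_one.2 fun b hb c hc => ?_
        have hb' := ((Finset.mem_filter.1 hb).2 i).resolve_left hi
        have hc' := ((Finset.mem_filter.1 hc).2 i).resolve_left hi
        exact Option.some.inj (hb'.symm.trans hc')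
      exact_mod_cast hle
  exact_mod_cast h3

/-- The converse against both receivers: the strings that they do not choose are a secret from them,
but can be decoded from the channel inputs, and so they are together not much longer than the number
of channel inputs that are erased at both receivers. -/
theorem one_le_of_secure_strings {p : Fin 2 → ℝ} (hp : ∀ i, p i ∈ Set.Icc (0 : ℝ) 1)
    (π : Protocol Bool (Option Bool) n k) {a : ℝ} (ha : 0 < a) (ha1 : a ≤ 1)
    (h : mutualInfo (π.law (independentBEC p)) (fun ω i => π.unchosen i ω) (fun ω i => π.viewB i ω) ≤
      ENNReal.ofReal (a ^ 2))
    (hc : ∀ i, mutualInfo (π.law (independentBEC p)) (π.choice i)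
      (fun ω => (π.viewA ω, π.viewB i.rev ω)) ≤ ENNReal.ofReal (a ^ 2)) (N : ℕ) :
    1 ≤ ∑ i, (π.law (independentBEC p) {ω | π.guess i ω ≠ π.chosen i ω} + ENNReal.ofReal (4 * a)) +
      π.law (independentBEC p) {ω | N < hits bothErased (π.received ω)} +
      (2 ^ N * (2 ^ (k 0 + k 1))⁻¹ + ENNReal.ofReal (2 * a)) := by
  classical
  have := isProbabilityMeasure_independentBEC hp
  choose dec hdec using fun i => π.exists_decoder_unchosen hp i ha ha1 (hc i)
  set X : (Fin 2 → Fin n → Option Bool) → Finset (Fin n → Bool) :=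
    fun y => {x | ∀ j, Compatible (x j) fun i => y i j} with hX
  -- The decoders are applied to all inputs compatible with the outputs, so the list is a function
  -- of the receivers' joint view.
  set L : (Fin 2 → Bool) → (Fin 2 → List (Option Bool) × List ℕ) → Finset (∀ i, Fin (k i) → Bool) :=
    fun z l => (X fun i => firstEntries n (l i).1).image fun x i => dec i (!z i) (x, (l i).2) with hL
  -- The bound on the number of double erasures is put into the event: it depends on the receivers'
  -- view only, so for each fixed view either the list is short or the event is empty.
  set R : Set ((∀ i, Fin (k i) → Bool) × (Fin 2 → Bool) × (Fin 2 → List (Option Bool) × List ℕ)) :=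
    {w | hits bothErased (fun i => firstEntries n (w.2.2 i).1) ≤ N ∧ w.1 ∈ L w.2.1 w.2.2} with hR
  have hm : Measurable fun w : (∀ i, Fin (k i) → Bool) ×
      (∀ i, Bool × π.RB i × List (Option Bool) × List ℕ) =>
      (w.1, (fun i => (w.2 i).1), fun i => (w.2 i).2.2) := by fun_prop
  have hEm := hm (MeasurableSet.of_discrete (s := R))
  set E := (fun w : (∀ i, Fin (k i) → Bool) × (∀ i, Bool × π.RB i × List (Option Bool) × List ℕ) =>
      (w.1, (fun i => (w.2 i).1), fun i => (w.2 i).2.2)) ⁻¹' R with hE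
  have hS : Measurable fun (ω : π.Sample) i => π.unchosen i ω :=
    measurable_of_outcome fun (o : Outcome Bool (Option Bool) n k) i => o.1 i (!(o.2.1 i).1)
  have hlist := measure_le_add_of_mutualInfo_le hS
    (measurable_pi_lambda _ fun i => π.measurable_viewB i) ha ha1 h hEm
    (c := 2 ^ N * (2 ^ (k 0 + k 1))⁻¹) (by
      intro v
      by_cases hv : hits bothErased (fun i => firstEntries n (v i).2.2.1) ≤ N
      · set F := L (fun i => (v i).1) fun i => (v i).2.2
        have hF : F.card ≤ 2 ^ N := Finset.card_image_le.trans ((card_compatible_le _).trans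
          (Nat.pow_le_pow_right two_pos hv))
        calc π.law (independentBEC p) {ω | ((fun i => π.unchosen i ω), v) ∈ E}
            ≤ ∑ m ∈ F, π.law (independentBEC p) {ω | (fun i => π.unchosen i ω) = m} := by
              refine (measure_mono fun ω hω => ?_).trans (measure_biUnion_finset_le F _)
              simpa using hω.2
          _ ≤ ∑ m ∈ F, ((2 : ℝ≥0∞) ^ (k 0 + k 1))⁻¹ :=
              Finset.sum_le_sum fun m _ => π.law_unchosen_le _ m
          _ = F.card * ((2 : ℝ≥0∞) ^ (k 0 + k 1))⁻¹ := by rw [Finset.sum_const, nsmul_eq_mul]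
          _ ≤ _ := by
              gcongr
              exact_mod_cast hF
      · simp [hE, hR, hv])
  calc (1 : ℝ≥0∞) = π.law (independentBEC p) Set.univ := measure_univ.symm
    _ ≤ π.law (independentBEC p) ((⋃ i ∈ (Finset.univ : Finset (Fin 2)),
          {ω | dec i (!π.choice i ω) (π.sent ω, π.transcript ω) ≠ π.unchosen i ω}) ∪
          {ω | ∃ j, ¬ Compatible (π.sent ω j) fun i => π.received ω i j} ∪
          {ω | N < hits bothErased (π.received ω)} ∪
          {ω | ((fun i => π.unchosen i ω), fun i => π.viewB i ω) ∈ E}) := by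
        refine measure_mono fun ω _ => ?_
        by_cases h1 : ∀ i, dec i (!π.choice i ω) (π.sent ω, π.transcript ω) = π.unchosen i ω
        · by_cases h2 : ∃ j, ¬ Compatible (π.sent ω j) fun i => π.received ω i j
          · exact .inl (.inl (.inr h2))
          · by_cases h3 : N < hits bothErased (π.received ω)
            · exact .inl (.inr h3)
            · refine .inr ⟨not_lt.1 h3, Finset.mem_image.2 ⟨π.sent ω, ?_, funext h1⟩⟩
              push Not at h2
              exact Finset.mem_filter.2 ⟨Finset.mem_univ _, h2⟩
        · push Not at h1
          refine .inl (.inl (.inl ?_))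
          simpa using h1
    _ ≤ _ := by
        refine (measure_union_le _ _).trans (add_le_add ?_ hlist)
        refine (measure_union_le _ _).trans (add_le_add ?_ le_rfl)
        refine (measure_union_le _ _).trans ?_
        rw [π.law_not_compatible hp, add_zero]
        exact (measure_biUnion_finset_le _ _).trans (Finset.sum_le_sum fun i _ => hdec i)

end Protocol

/-! ### From single protocols to rates -/

/-- If `K > N + 6`, the last term is at most `4 / 64 = 1 / 16`, too little to fill the gap of `1 /
8`. -/
theorem length_le_of_one_le {c : ℝ≥0∞} {N K : ℕ} (hc : c ≤ ENNReal.ofReal (7 / 8))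
    (h : 1 ≤ c + 2 ^ N * (4 * (2 ^ K)⁻¹)) : K ≤ N + 6 := by
  by_contra! hK
  have h1 : (2 : ℝ≥0∞) ^ N * (4 * (2 ^ K)⁻¹) = ENNReal.ofReal (2 ^ N * (4 * (2 ^ K)⁻¹)) := by
    rw [ENNReal.ofReal_mul (by positivity), ENNReal.ofReal_mul (by positivity),
      ENNReal.ofReal_inv_of_pos (by positivity), ENNReal.ofReal_pow (by positivity),
      ENNReal.ofReal_pow (by positivity)]
    simp
  have h2 := h.trans (add_le_add hc le_rfl)
  rw [h1, ← ENNReal.ofReal_add (by positivity) (by positivity), ENNReal.one_le_ofReal] at h2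
  have h3 : (2 : ℝ) ^ N * 64 ≤ 2 ^ K := by
    calc (2 : ℝ) ^ N * 64 = 2 ^ (N + 6) := by rw [pow_add]; norm_num
      _ ≤ 2 ^ K := pow_le_pow_right₀ one_le_two hK.le
  have h4 : (2 : ℝ) ^ N * (4 * (2 ^ K)⁻¹) ≤ 1 / 16 := by
    rw [← mul_assoc, ← div_eq_mul_inv, div_le_iff₀ (by positivity)]
    linarith
  linarith

/-- If strings of length `K n` obey a secrecy converse with the number of hits of an event of
probability `r`, then their rate is at most `r`. -/
theorem rate_le_of_eventually {K : ℕ → ℕ} {r R : ℝ} (hr : 0 ≤ r)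
    (hK : Tendsto (fun n => (K n : ℝ) / n) atTop (𝓝 R))
    (h : ∀ s, r < s → ∃ c : ℕ → ℝ≥0∞, (∀ᶠ n in atTop, c n ≤ ENNReal.ofReal (7 / 8)) ∧
      ∀ᶠ n : ℕ in atTop, 1 ≤ c n + 2 ^ ⌊n * s⌋₊ * (4 * (2 ^ K n)⁻¹)) : R ≤ r := by
  refine le_of_forall_gt_imp_ge_of_dense fun s hs => ?_
  obtain ⟨c, hc, hc'⟩ := h s hs
  have hlim : Tendsto (fun n : ℕ => s + 6 / n) atTop (𝓝 (s + 0)) :=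
    tendsto_const_nhds.add (tendsto_const_div_atTop_nhds_zero_nat 6)
  rw [add_zero] at hlim
  refine le_of_tendsto_of_tendsto hK hlim ?_
  filter_upwards [hc, hc', eventually_gt_atTop 0] with n h1 h2 hn
  have hn' : (0 : ℝ) < n := Nat.cast_pos.2 hn
  have h3 : (K n : ℝ) ≤ ⌊n * s⌋₊ + 6 := by exact_mod_cast length_le_of_one_le h1 h2
  have h4 : (⌊n * s⌋₊ : ℝ) ≤ n * s := Nat.floor_le (by nlinarith)
  rw [div_le_iff₀ hn', add_mul, div_mul_cancel₀ _ hn'.ne']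
  linarith

theorem eventually_law_floor_lt_hits_le {𝒳 𝒴 : Type} [Inhabited 𝒳] [Inhabited 𝒴] [Fintype 𝒳]
    [Finite 𝒴] [MeasurableSpace 𝒴] [MeasurableSingletonClass 𝒴]
    (W : 𝒳 → Measure (Fin 2 → 𝒴)) [∀ x, IsProbabilityMeasure (W x)]
    (E : Set (Fin 2 → 𝒴)) {r s ε : ℝ} (hr : 0 ≤ r) (hr1 : r ≤ 1) (hrs : r < s)
    (hE : ∀ x, W x E = ENNReal.ofReal r) (hε : 0 < ε) {k : ℕ → Fin 2 → ℕ}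
    (π : ∀ n, Protocol 𝒳 𝒴 n (k n)) :
    ∀ᶠ n : ℕ in atTop, (π n).law W {ω | ⌊n * s⌋₊ < Protocol.hits E ((π n).received ω)} ≤
      ENNReal.ofReal ε := by
  obtain ⟨q, hq, hb⟩ := Protocol.exists_law_hits_le W E hr hr1 hrs hE
  have hlim := ENNReal.tendsto_pow_atTop_nhds_zero_of_lt_one hq
  filter_upwards [hlim.eventually_le_const (ENNReal.ofReal_pos.2 hε)] with n hn
  refine (measure_mono fun ω hω => ?_).trans ((hb n (k n) (π n)).trans hn)
  exact Nat.lt_of_floor_lt hω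

namespace AchievesColluding

variable {p : Fin 2 → ℝ} {R : Fin 2 → ℝ} {k : ℕ → Fin 2 → ℕ}
  {π : ∀ n, Protocol Bool (Option Bool) n (k n)}

theorem rate_nonneg (h : AchievesColluding (independentBEC p) R k π) (i : Fin 2) : 0 ≤ R i :=
  ge_of_tendsto' (h.rate i) fun n => by positivity

theorem rate_le (hp : ∀ i, p i ∈ Set.Icc (0 : ℝ) 1)
    (h : AchievesColluding (independentBEC p) R k π) (i : Fin 2) :
    R i ≤ p i.rev * (1 - p i) := by
  have := isProbabilityMeasure_independentBEC hp
  have hr0 : 0 ≤ p i.rev * (1 - p i) := mul_nonneg (hp i.rev).1 (by linarith [(hp i).2])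
  have hr1 : p i.rev * (1 - p i) ≤ 1 :=
    mul_le_one₀ (hp i.rev).2 (by linarith [(hp i).2]) (by linarith [(hp i).1])
  have hε : (0 : ℝ≥0∞) < ENNReal.ofReal (1 / 100) := by simp
  refine rate_le_of_eventually hr0 (h.rate i) fun s hs => ⟨fun n =>
    (π n).law (independentBEC p) {ω | (π n).guess i ω ≠ (π n).chosen i ω} +
    (π n).law (independentBEC p)
      {ω | ⌊n * s⌋₊ < Protocol.hits (onlyOtherErased i) ((π n).received ω)} +
    (4⁻¹ + ENNReal.ofReal (2 * (1 / 100))), ?_, ?_⟩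
  · filter_upwards [(h.correct i).eventually_le_const hε,
      eventually_law_floor_lt_hits_le (independentBEC p) (onlyOtherErased i) hr0 hr1 hs
        (independentBEC_onlyOtherErased hp i) (by norm_num : (0 : ℝ) < 1 / 100) π] with n h1 h2
    refine (add_le_add (add_le_add h1 h2) le_rfl).trans ?_
    have h4 : (4⁻¹ : ℝ≥0∞) = ENNReal.ofReal 4⁻¹ := by
      rw [ENNReal.ofReal_inv_of_pos (by norm_num)]
      simp
    rw [h4, ← ENNReal.ofReal_add (by norm_num) (by norm_num),
      ← ENNReal.ofReal_add (by norm_num) (by norm_num),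
      ← ENNReal.ofReal_add (by norm_num) (by norm_num)]
    exact ENNReal.ofReal_le_ofReal (by norm_num)
  -- A fixed level `a = 1 / 100` of secrecy suffices, since the errors need only sum to at most `7 /
  -- 8`.
  · have hε' : (0 : ℝ≥0∞) < ENNReal.ofReal ((1 / 100) ^ 2) := by simp
    filter_upwards [(h.secure_single i).eventually_le_const hε'] with n hn
    exact (π n).one_le_of_secure_single hp i (by norm_num) (by norm_num) hn _

theorem sum_rate_le (hp : ∀ i, p i ∈ Set.Icc (0 : ℝ) 1)
    (h : AchievesColluding (independentBEC p) R k π) : R 0 + R 1 ≤ p 0 * p 1 := by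
  have := isProbabilityMeasure_independentBEC hp
  have hr0 : 0 ≤ p 0 * p 1 := mul_nonneg (hp 0).1 (hp 1).1
  have hr1 : p 0 * p 1 ≤ 1 := mul_le_one₀ (hp 0).2 (hp 1).1 (hp 1).2
  have hε : (0 : ℝ≥0∞) < ENNReal.ofReal (1 / 100) := by simp
  have hrate : Tendsto (fun n => ((k n 0 + k n 1 : ℕ) : ℝ) / n) atTop (𝓝 (R 0 + R 1)) := by
    refine ((h.rate 0).add (h.rate 1)).congr fun n => ?_
    rw [Nat.cast_add, add_div]
  refine rate_le_of_eventually (K := fun n => k n 0 + k n 1) hr0 hrate fun s hs => ⟨fun n =>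
    ∑ i, ((π n).law (independentBEC p) {ω | (π n).guess i ω ≠ (π n).chosen i ω} +
      ENNReal.ofReal (4 * (1 / 100))) +
    (π n).law (independentBEC p)
      {ω | ⌊n * s⌋₊ < Protocol.hits bothErased ((π n).received ω)} +
    ENNReal.ofReal (2 * (1 / 100)), ?_, ?_⟩
  · filter_upwards [(h.correct 0).eventually_le_const hε, (h.correct 1).eventually_le_const hε,
      eventually_law_floor_lt_hits_le (independentBEC p) bothErased hr0 hr1 hs
        (independentBEC_bothErased hp) (by norm_num : (0 : ℝ) < 1 / 100) π] with n h0 h1 h2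
    rw [Fin.sum_univ_two]
    refine (add_le_add (add_le_add (add_le_add (add_le_add h0 le_rfl) (add_le_add h1 le_rfl)) h2)
      le_rfl).trans ?_
    rw [← ENNReal.ofReal_add (by norm_num) (by norm_num),
      ← ENNReal.ofReal_add (by norm_num) (by norm_num),
      ← ENNReal.ofReal_add (by norm_num) (by norm_num),
      ← ENNReal.ofReal_add (by norm_num) (by norm_num)]
    exact ENNReal.ofReal_le_ofReal (by norm_num)
  · have hε' : (0 : ℝ≥0∞) < ENNReal.ofReal ((1 / 100) ^ 2) := by simp
    filter_upwards [h.secure_strings.eventually_le_const hε',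
      eventually_all.2 fun i => (h.secure_choice i).eventually_le_const hε'] with n h1 h2
    refine ((π n).one_le_of_secure_strings hp (by norm_num) (by norm_num) h1 h2 ⌊n * s⌋₊).trans ?_
    -- The exponential term lacks the factor 4 of `rate_le_of_eventually`, which may be inserted as
    -- `1 ≤ 4`.
    rw [add_comm (2 ^ ⌊n * s⌋₊ * _), ← add_assoc]
    gcongr
    exact le_mul_of_one_le_left' (by norm_num)

end AchievesColluding

end BroadcastOT

end

theorem mainTheorem7 (p : Fin 2 → ℝ) (hp : ∀ i, p i ∈ Set.Icc (0 : ℝ) 1) :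
    BroadcastOT.rateRegionColluding (BroadcastOT.independentBEC p) ⊆
      {R : Fin 2 → ℝ | (0 ≤ R 0 ∧ 0 ≤ R 1) ∧
        R 0 ≤ p 1 * min (p 0) (1 - p 0) ∧
        R 1 ≤ p 0 * min (p 1) (1 - p 1) ∧
        R 0 + R 1 ≤ min (p 0 * p 1) (1 - p 0 * p 1)} := by
  rintro R ⟨k, π, h⟩
  have h0 := h.rate_nonneg 0
  have h1 := h.rate_nonneg 1
  have h2 : R 0 ≤ p 1 * (1 - p 0) := h.rate_le hp 0
  have h3 : R 1 ≤ p 0 * (1 - p 1) := h.rate_le hp 1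
  have h4 := h.sum_rate_le hp
  obtain ⟨hp0, hp0'⟩ := hp 0
  obtain ⟨hp1, hp1'⟩ := hp 1
  -- The bound `1 - p 0 * p 1` is the sum of `h2` and `h3` weakened by `(1 - p 0) * (1 - p 1) ≥ 0`.
  -- The bounds `R i ≤ p 0 * p 1` come from `h4`, as the other rate is nonnegative.
  refine ⟨⟨h0, h1⟩, ?_, ?_, le_min h4 (by nlinarith)⟩
  · rw [mul_min_of_nonneg _ _ hp1]
    exact le_min (by linarith) h2
  · rw [mul_min_of_nonneg _ _ hp0]
    exact le_min (by linarith) h3
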